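/- **Setting.** Fix a finite set of colours $\{1,\dots,s\}$ with arities $n_i>1$. An $\Omega$-algebra is a set with operations $\lambda_i:U^{n_i}\to U$ and $\alpha_i^1,\dots,\alpha_i^{n_i}:U\to U$ for each colour $i$ (the $\alpha_i^j$ written on the right). Let $\Sigma=\Sigma_1\cup\Sigma_2$ be a set of laws, where $\Sigma_1$ says that $u\mapsto(u\alpha_i^1,\dots,u\alpha_i^{n_i})$ and $\lambda_i$ are mutually inverse for every $i$, and where, for each pair of colours $i<i'$, $\Sigma_2$ contains either nothing or all laws $u\nu=u\phi(\nu)$ $(\nu\in\Lambda_i)$ for some maps $f:\{1,\dots,n_i\}\to\{1,\dots,s\}$, $f':\{1,\dots,n_{i'}\}\to\{1,\dots,s\}$ and some bijection $\phi:\Lambda_i\to\Lambda_{i'}$ between $\Lambda_i=\{\alpha_i^j\alpha_{f(j)}^k : 1\le j\le n_i,\ 1\le k\le n_{f(j)}\}$ and $\Lambda_{i'}=\{\alpha_{i'}^j\alpha_{f'(j)}^k : 1\le j\le n_{i'},\ 1\le k\le n_{f'(j)}\}$. For a set $X$ with $r$ elements let $W_\Omega(X)$ be the free $\Omega$-algebra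 (word algebra) on $X$, and let $U_r(\Sigma)$ be its quotient by the fully invariant congruence generated by $\Sigma$. A simple expansion of a set $A$ replaces some $a\in A$ by $a\alpha_i^1,\dots,a\alpha_i^{n_i}$; a simple contraction replaces pairwise distinct $a_1,\dots,a_{n_i}\in A$ by $(a_1,\dots,a_{n_i})\lambda_i$. Write $A\le B$ if $B$ is obtained from $A$ by finitely many simple expansions. A set is admissible if it is obtained from (the image of) $X$ by finitely many simple expansions and contractions. A basis of $U_r(\Sigma)$ is a free basis in the class of $\Omega$-algebras satisfying $\Sigma$. The algebra $U_r(\Sigma)$ is valid if every admissible subset of $W_\Omega(X)$ has the same cardinality as its image in $U_r(\Sigma)$, and bounded if any two admissible subsets of $U_r(\Sigma)$ that have a common admissible lower bound have a unique least upper bound among admissible subsets. $V_r(\Sigma)$ is the group of those $\Omega$-algebra automorphisms of $U_r(\Sigma)$ that are induced by a map between two admissible subsets of the same cardinality; it acts on the left. For a group $L$ let $\varinjlim(U_l(\Sigma),L)$ be the colimit, in the category of groups, of the following diagram: to each basis $A$ of $U_l(\Sigma)$ it assigns the group $\mathrm{Maps}(A,L)$ of all maps $A\to L$ with pointwise multiplication,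 and to each simple expansion $B=(A\setminus\{a\})\cup\{a\alpha_i^1,\dots,a\alpha_i^{n_i}\}$ of bases the diagonal map $\delta:\mathrm{Maps}(A,L)\to\mathrm{Maps}(B,L)$ with $\delta(f)(a\alpha_i^j)=f(a)$ for all $j$ and $\delta(f)(c)=f(c)$ for $c\in A\setminus\{a\}$. **Theorem 4.2.** Assume that $U_r(\Sigma)$ is valid and bounded and let $Q$ be a finite subgroup of $V_r(\Sigma)$. Let $\varphi_i:Q\to S_{m_i}$ $(1\le i\le t)$ be the transitive permutation representations of $Q$ (with $m_i\ge1$), each listed exactly once up to equivalence, and put $L_i=C_{S_{m_i}}(\varphi_i(Q))$. Then there is a basis $Y$ of $U_r(\Sigma)$ that is setwise fixed by $Q$ and of minimal cardinality among such bases. For every such $Y$, let $r_i$ be the number of $Q$-orbits in $Y$ of type $\varphi_i$. If $s\ge1$, then $0\le r_i\le d:=\gcd\{n_j-1 : 1\le j\le s\}$ for all $i$. Moreover (for every $s$) $$C_{V_r(\Sigma)}(Q)\;\cong\;\prod_{i=1}^t G_i,\qquad G_i=K_i\rtimes V_{r_i}(\Sigma),\qquad K_i=\varinjlim(U_{r_i}(\Sigma),L_i),$$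 where $V_{r_i}(\Sigma)$ acts on $K_i$ as follows: $g\in V_{r_i}(\Sigma)$ sends the class of $f\in\mathrm{Maps}(A,L_i)$, for a basis $A$ of $U_{r_i}(\Sigma)$, to the class of $f\circ g^{-1}\in\mathrm{Maps}(gA,L_i)$. -/

import Mathlib

namespace CantorAlg

/-- A non-empty set of laws between the colours `i` and `i'`.  An element `⟨j, k⟩` of
`Σ j, Fin (n (f j))` stands for the length two descending word `α_i^j α_{f j}^k`
(first `α_i^j`, then `α_{f j}^k`), and `φ` is the bijection between the two sets of words. -/
structure PairLaws {s : ℕ} (n : Fin s → ℕ) (i i' : Fin s) where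
  f : Fin (n i) → Fin s
  f' : Fin (n i') → Fin s
  φ : (Σ j : Fin (n i), Fin (n (f j))) ≃ (Σ j : Fin (n i'), Fin (n (f' j)))

/-- The colours, their arities and the laws defining a Cantor algebra.  `laws i i' h = none` means
that there is no second kind of law between `i` and `i'`. -/
structure CantorSystem where
  s : ℕ
  n : Fin s → ℕ
  one_lt : ∀ i, 1 < n i
  laws : ∀ i i' : Fin s, i < i' → Option (PairLaws n i i')

/-- The number `d = gcd {n_i - 1}`. -/
def CantorSystem.d (S : CantorSystem) : ℕ := Finset.univ.gcd fun i => S.n i - 1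

/-- `Ω`-algebras. -/
class OmegaAlgebra (S : CantorSystem) (U : Type) where
  lam : ∀ i : Fin S.s, (Fin (S.n i) → U) → U
  alpha : ∀ i : Fin S.s, Fin (S.n i) → U → U

section General

variable (S : CantorSystem) {U M : Type} [OmegaAlgebra S U] [OmegaAlgebra S M]

/-- Morphisms of `Ω`-algebras. -/
def IsHom (h : U → M) : Prop :=
  (∀ i v, h (OmegaAlgebra.lam i v) = OmegaAlgebra.lam (S := S) i (fun j => h (v j))) ∧
  ∀ i j u, h (OmegaAlgebra.alpha i j u) = OmegaAlgebra.alpha (S := S) i j (h u)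

variable (U) in
/-- The `Ω`-algebra `U` satisfies all the laws. -/
def Satisfies : Prop :=
  (∀ i (u : U), OmegaAlgebra.lam (S := S) i (fun j => OmegaAlgebra.alpha (S := S) i j u) = u) ∧
  (∀ i (v : Fin (S.n i) → U) j,
    OmegaAlgebra.alpha (S := S) i j (OmegaAlgebra.lam (S := S) i v) = v j) ∧
  ∀ i i' (h : i < i') (p : PairLaws S.n i i'), S.laws i i' h = some p →
    ∀ (u : U) (w : Σ j : Fin (S.n i), Fin (S.n (p.f j))),
      OmegaAlgebra.alpha (S := S) (p.f w.1) w.2 (OmegaAlgebra.alpha (S := S) i w.1 u) =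
      OmegaAlgebra.alpha (S := S) (p.f' (p.φ w).1) (p.φ w).2
        (OmegaAlgebra.alpha (S := S) i' (p.φ w).1 u)

/-- The set obtained from `A` by replacing `a` by `a α_i^1, …, a α_i^{n_i}`. -/
def expand (A : Set U) (a : U) (i : Fin S.s) : Set U :=
  (A \ {a}) ∪ Set.range fun j => OmegaAlgebra.alpha (S := S) i j a

/-- `B` is a simple expansion of `A`. -/
def SimpleExpansion (A B : Set U) : Prop := ∃ a ∈ A, ∃ i : Fin S.s, B = expand S A a i

/-- `B` is a simple contraction of `A`. -/
def SimpleContraction (A B : Set U) : Prop :=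
  ∃ (i : Fin S.s) (b : Fin (S.n i) → U), Function.Injective b ∧ Set.range b ⊆ A ∧
    B = (A \ Set.range b) ∪ {OmegaAlgebra.lam (S := S) i b}

/-- `A ≤ B`: the set `B` is obtained from `A` by expansions only. -/
def Le (A B : Set U) : Prop := Relation.ReflTransGen (SimpleExpansion S) A B

/-- `A` is obtained from `X` by finitely many expansions and contractions. -/
def AdmissibleFrom (X A : Set U) : Prop :=
  Relation.ReflTransGen (fun B C => SimpleExpansion S B C ∨ SimpleContraction S B C) X A

/-- `A` is a free basis of `U` in the class of `Ω`-algebras satisfying the laws. -/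
def IsBasis (A : Set U) : Prop :=
  ∀ (N : Type) [OmegaAlgebra S N], Satisfies S N → ∀ θ : A → N,
    ∃! h : U → N, IsHom S h ∧ ∀ a : A, h a = θ a

variable (U) in
/-- The group of `Ω`-algebra automorphisms of `U`. -/
def autGroup : Subgroup (Equiv.Perm U) where
  carrier := {g | IsHom S (g : U → U)}
  one_mem' := ⟨fun _ _ => rfl, fun _ _ _ => rfl⟩
  mul_mem' := by
    rintro g h ⟨hg, hg'⟩ ⟨hh, hh'⟩
    exact ⟨fun i v => by simp [hh, hg], fun i j u => by simp [hh', hg']⟩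
  inv_mem' := by
    rintro g ⟨hg, hg'⟩
    refine ⟨fun i v => ?_, fun i j u => ?_⟩
    · rw [Equiv.Perm.inv_eq_iff_eq, hg]; simp
    · rw [Equiv.Perm.inv_eq_iff_eq, hg']; simp

variable {S}

theorem IsHom.comp {N : Type} [OmegaAlgebra S N] {h : U → M} {k : M → N}
    (hk : IsHom S k) (hh : IsHom S h) : IsHom S (k ∘ h) :=
  ⟨fun i v => by simp [hh.1, hk.1], fun i j u => by simp [hh.2, hk.2]⟩

theorem IsBasis.image {A : Set U} (hA : IsBasis S A) {g : Equiv.Perm U}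
    (hg : g ∈ autGroup S U) : IsBasis S (g '' A) := by
  intro N _ hN θ
  obtain ⟨h, ⟨hh, hθ⟩, hu⟩ := hA N hN (fun a => θ ⟨g a, Set.mem_image_of_mem _ a.2⟩)
  refine ⟨h ∘ (g⁻¹ : Equiv.Perm U), ⟨hh.comp ((autGroup S U).inv_mem hg), ?_⟩, ?_⟩
  · rintro ⟨_, a, ha, rfl⟩
    simpa using hθ ⟨a, ha⟩
  · rintro k ⟨hk, hk'⟩
    have := hu (k ∘ g) ⟨hk.comp hg, fun a => hk' ⟨g a, Set.mem_image_of_mem _ a.2⟩⟩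
    rw [← this]
    funext x
    simp

theorem image_expand {g : Equiv.Perm U} (hg : g ∈ autGroup S U) (A : Set U) (a : U)
    (i : Fin S.s) : g '' expand S A a i = expand S (g '' A) (g a) i := by
  have h2 : ∀ j, g (OmegaAlgebra.alpha (S := S) i j a) = OmegaAlgebra.alpha (S := S) i j (g a) :=
    fun j => hg.2 i j a
  rw [expand, expand, Set.image_union, Set.image_sdiff g.injective, Set.image_singleton,
    ← Set.range_comp]
  congr 2
  funext j
  exact h2 j

end General

section WordAlgebra

/-- The `Ω`-word algebra on `X`. -/
inductive Word (S : CantorSystem) (X : Type) : Type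
  | var : X → Word S X
  | lam : ∀ i : Fin S.s, (Fin (S.n i) → Word S X) → Word S X
  | alpha : ∀ i : Fin S.s, Fin (S.n i) → Word S X → Word S X

instance (S : CantorSystem) (X : Type) : OmegaAlgebra S (Word S X) where
  lam := Word.lam
  alpha := Word.alpha

/-- The fully invariant congruence on the word algebra generated by the laws. -/
inductive Cong (S : CantorSystem) (X : Type) : Word S X → Word S X → Prop
  | refl (u) : Cong S X u u
  | symm {u v} : Cong S X u v → Cong S X v u
  | trans {u v w} : Cong S X u v → Cong S X v w → Cong S X u w
  | lam (i) {u v : Fin (S.n i) → Word S X} :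
      (∀ j, Cong S X (u j) (v j)) → Cong S X (.lam i u) (.lam i v)
  | alpha (i j) {u v} : Cong S X u v → Cong S X (.alpha i j u) (.alpha i j v)
  | alpha_lam (i u) : Cong S X (.lam i fun j => .alpha i j u) u
  | lam_alpha (i) (u : Fin (S.n i) → Word S X) (j) : Cong S X (.alpha i j (.lam i u)) (u j)
  | pair (i i') (h : i < i') (p : PairLaws S.n i i') (hp : S.laws i i' h = some p) (u)
      (w : Σ j : Fin (S.n i), Fin (S.n (p.f j))) :
      Cong S X (.alpha (p.f w.1) w.2 (.alpha i w.1 u))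
        (.alpha (p.f' (p.φ w).1) (p.φ w).2 (.alpha i' (p.φ w).1 u))

/-- The congruence as a setoid. -/
def congSetoid (S : CantorSystem) (X : Type) : Setoid (Word S X) :=
  ⟨Cong S X, .refl, .symm, .trans⟩

/-- The Cantor algebra `U_r(Σ)`, with generating set `X = Fin r`. -/
def CAlg (S : CantorSystem) (r : ℕ) : Type := Quotient (congSetoid S (Fin r))

/-- The projection of the word algebra onto the Cantor algebra. -/
def proj (S : CantorSystem) (r : ℕ) : Word S (Fin r) → CAlg S r :=
  Quotient.mk (congSetoid S (Fin r))

noncomputable instance (S : CantorSystem) (r : ℕ) : OmegaAlgebra S (CAlg S r) where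
  lam i v := proj S r (.lam i fun j => Quotient.out (v j))
  alpha i j := Quotient.map (sa := congSetoid S (Fin r)) (sb := congSetoid S (Fin r))
    (Word.alpha i j) fun _ _ h => Cong.alpha i j h

theorem isHom_proj (S : CantorSystem) (r : ℕ) : IsHom S (proj S r) := by
  refine ⟨fun i v => ?_, fun i j u => rfl⟩
  refine Quotient.sound (s := congSetoid S (Fin r)) (Cong.lam i fun j => Cong.symm ?_)
  exact Quotient.exact (s := congSetoid S (Fin r)) (Quotient.out_eq _)

/-- The admissible subsets of `W_Ω(X)`. -/
def WAdmissible (S : CantorSystem) (r : ℕ) (A : Set (Word S (Fin r))) : Prop :=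
  AdmissibleFrom S (Set.range Word.var) A

/-- The admissible subsets of `U_r(Σ)`. -/
def Admissible (S : CantorSystem) (r : ℕ) (A : Set (CAlg S r)) : Prop :=
  AdmissibleFrom S (Set.range fun x => proj S r (.var x)) A

/-- `U_r(Σ)` is valid: admissible subsets of `W_Ω(X)` keep their cardinality in `U_r(Σ)`. -/
def Valid (S : CantorSystem) (r : ℕ) : Prop :=
  ∀ A, WAdmissible S r A → (proj S r '' A).encard = A.encard

/-- `U_r(Σ)` is bounded: any two admissible subsets with an admissible lower bound have a unique
least upper bound. -/
def Bounded (S : CantorSystem) (r : ℕ) : Prop :=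
  ∀ Y Z, Admissible S r Y → Admissible S r Z →
    (∃ A, Admissible S r A ∧ Le S A Y ∧ Le S A Z) →
    ∃! T, Admissible S r T ∧ Le S Y T ∧ Le S Z T ∧
      ∀ T', Admissible S r T' → Le S Y T' → Le S Z T' → Le S T T'

end WordAlgebra

section Groups

/-- The automorphism `g` is induced by a map between two admissible subsets of the same
cardinality. -/
def IsInduced (S : CantorSystem) (r : ℕ) (g : Equiv.Perm (CAlg S r)) : Prop :=
  g ∈ autGroup S (CAlg S r) ∧ ∃ A B, Admissible S r A ∧ Admissible S r B ∧
    A.encard = B.encard ∧ g '' A = B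

/-- The group `V_r(Σ)`.  When the algebra is valid, the induced automorphisms already form a group,
so that taking the generated subgroup adds no elements; it makes the definition meaningful without
a proof of validity. -/
def V (S : CantorSystem) (r : ℕ) : Subgroup (Equiv.Perm (CAlg S r)) :=
  Subgroup.closure {g | IsInduced S r g}

theorem V_le_autGroup (S : CantorSystem) (r : ℕ) : V S r ≤ autGroup S (CAlg S r) :=
  (Subgroup.closure_le _).2 fun _ hg => hg.1

/-- The bases of `U_r(Σ)`. -/
abbrev Bases (S : CantorSystem) (r : ℕ) : Type := {A : Set (CAlg S r) // IsBasis S A}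

/-- The action of `V_r(Σ)` on the bases. -/
def moveBasis {S : CantorSystem} {r : ℕ} (g : V S r) (A : Bases S r) : Bases S r :=
  ⟨(g : Equiv.Perm (CAlg S r)) '' A.1, A.2.image (V_le_autGroup S r g.2)⟩

variable (S : CantorSystem) (r : ℕ) (L : Type) [Group L]

variable {S r L} in
open Classical in
/-- The diagonal map `Maps(A, L) → Maps(B, L)` where `B` is obtained from `A` by expanding `a`:
it takes the value `f a` on all `a α_i^j`, and agrees with `f` on `A \ {a}`. -/
noncomputable def diag {A : Set (CAlg S r)} {a : CAlg S r} (ha : a ∈ A) (i : Fin S.s)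
    (f : A → L) : expand S A a i → L := fun b =>
  if h : b.1 ∈ Set.range fun j => OmegaAlgebra.alpha (S := S) i j a then f ⟨a, ha⟩
  else f ⟨b.1, (b.2.resolve_right h).1⟩

/-- The relators of the colimit: one family makes each `Maps(A, L) → K` multiplicative, the other
identifies `f` with its image under the diagonal map of each simple expansion of bases. -/
inductive ColimRel : FreeGroup (Σ A : Bases S r, A.1 → L) → Prop
  | mul (A : Bases S r) (f g : A.1 → L) :
      ColimRel (.of ⟨A, f⟩ * .of ⟨A, g⟩ * (.of ⟨A, f * g⟩)⁻¹)
  | edge (A : Bases S r) (a : CAlg S r) (ha : a ∈ A.1) (i : Fin S.s)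
      (hB : IsBasis S (expand S A.1 a i)) (f : A.1 → L) :
      ColimRel (.of ⟨A, f⟩ * (.of ⟨⟨expand S A.1 a i, hB⟩, diag ha i f⟩)⁻¹)

/-- The colimit, in the category of groups, of the diagram `(U_r(Σ), L)` that assigns the group
`Maps(A, L)` to each basis `A` and the diagonal map to each simple expansion. -/
def Colim : Type := PresentedGroup {w | ColimRel S r L w}

instance : Group (Colim S r L) :=
  inferInstanceAs (Group (PresentedGroup {w | ColimRel S r L w}))

variable {S r L}

/-- The class in the colimit of `f : A → L`. -/
def Colim.mk (A : Bases S r) (f : A.1 → L) : Colim S r L :=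
  PresentedGroup.of (rels := {w | ColimRel S r L w}) ⟨A, f⟩

theorem Colim.mk_congr {A B : Bases S r} {f : A.1 → L} {g : B.1 → L} (h : A.1 = B.1)
    (hfg : ∀ x (hA : x ∈ A.1) (hB : x ∈ B.1), f ⟨x, hA⟩ = g ⟨x, hB⟩) :
    Colim.mk A f = Colim.mk B g := by
  obtain ⟨A, hA⟩ := A
  obtain ⟨B, hB⟩ := B
  obtain rfl : A = B := h
  congr 1
  funext x
  exact hfg x.1 x.2 x.2

theorem Colim.mk_mul (A : Bases S r) (f g : A.1 → L) :
    Colim.mk A (f * g) = Colim.mk A f * Colim.mk A g := by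
  have h := PresentedGroup.one_of_mem (rels := {w | ColimRel S r L w}) (ColimRel.mul A f g)
  rw [map_mul, map_mul, map_inv, mul_inv_eq_one] at h
  exact h.symm

theorem Colim.mk_edge (A : Bases S r) {a : CAlg S r} (ha : a ∈ A.1) (i : Fin S.s)
    (hB : IsBasis S (expand S A.1 a i)) (f : A.1 → L) :
    Colim.mk ⟨expand S A.1 a i, hB⟩ (diag ha i f) = Colim.mk A f := by
  have h := PresentedGroup.one_of_mem (rels := {w | ColimRel S r L w}) (ColimRel.edge A a ha i hB f)
  rw [map_mul, map_inv, mul_inv_eq_one] at h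
  exact h.symm

/-- The map `Maps(A, L) → Maps(gA, L)` obtained contravariantly from `g⁻¹ : gA → A`. -/
def moveMap (g : V S r) (A : Bases S r) (f : A.1 → L) : (moveBasis g A).1 → L := fun x =>
  f ⟨(g : Equiv.Perm (CAlg S r)).symm x.1, by
    obtain ⟨_, a, ha, rfl⟩ := x
    simpa using ha⟩

theorem Colim.mk_move_diag (g : V S r) (A : Bases S r) {a : CAlg S r} (ha : a ∈ A.1)
    (i : Fin S.s) (hB : IsBasis S (expand S A.1 a i)) (f : A.1 → L) :
    Colim.mk (moveBasis g ⟨expand S A.1 a i, hB⟩) (moveMap g ⟨expand S A.1 a i, hB⟩ (diag ha i f)) =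
      Colim.mk (moveBasis g A) (moveMap g A f) := by
  have hg := V_le_autGroup S r g.2
  have himg := image_expand hg A.1 a i
  have hga : (g : Equiv.Perm (CAlg S r)) a ∈ (moveBasis g A).1 := Set.mem_image_of_mem _ ha
  rw [← Colim.mk_edge (moveBasis g A) hga i (himg ▸ hB.image hg)]
  refine Colim.mk_congr himg ?_
  intro x hx hx'
  have key : (g : Equiv.Perm (CAlg S r)).symm x ∈
        Set.range (fun j => OmegaAlgebra.alpha (S := S) i j a) ↔
      x ∈ Set.range (fun j => OmegaAlgebra.alpha (S := S) i j
        ((g : Equiv.Perm (CAlg S r)) a)) := by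
    refine exists_congr fun j => ?_
    rw [Equiv.eq_symm_apply]
    exact iff_of_eq (congrArg (· = x) (hg.2 i j a))
  by_cases h : x ∈ Set.range (fun j => OmegaAlgebra.alpha (S := S) i j
        ((g : Equiv.Perm (CAlg S r)) a))
  · simp only [moveMap, diag, dif_pos h, dif_pos (key.2 h)]
    congr 1
    simp
  · simp only [moveMap, diag, dif_neg h, dif_neg (mt key.1 h)]

/-- The endomorphism of the colimit induced by `g`. -/
def Colim.move (g : V S r) : Colim S r L →* Colim S r L :=
  PresentedGroup.toGroup (rels := {w | ColimRel S r L w})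
    (f := fun x => Colim.mk (moveBasis g x.1) (moveMap g x.1 x.2)) (by
    intro w hw
    cases hw with
    | mul A f f' =>
      simp only [map_mul, map_inv, FreeGroup.lift_apply_of]
      rw [mul_inv_eq_one, ← Colim.mk_mul]
      rfl
    | edge A a ha i hB f =>
      simp only [map_mul, map_inv, FreeGroup.lift_apply_of]
      rw [mul_inv_eq_one, Colim.mk_move_diag])

theorem Colim.move_mk (g : V S r) (A : Bases S r) (f : A.1 → L) :
    Colim.move g (Colim.mk A f) = Colim.mk (moveBasis g A) (moveMap g A f) :=
  PresentedGroup.toGroup.of _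

theorem Colim.hom_ext {H : Type} [Group H] {p q : Colim S r L →* H}
    (h : ∀ A f, p (Colim.mk A f) = q (Colim.mk A f)) : p = q :=
  PresentedGroup.ext fun x => h x.1 x.2

theorem Colim.move_one : Colim.move (1 : V S r) = MonoidHom.id (Colim S r L) := by
  refine Colim.hom_ext fun A f => ?_
  rw [Colim.move_mk]
  exact Colim.mk_congr (Set.image_id _) fun _ _ _ => rfl

theorem Colim.move_mul (g h : V S r) :
    Colim.move (L := L) (g * h) = (Colim.move g).comp (Colim.move h) := by
  refine Colim.hom_ext fun A f => ?_
  rw [MonoidHom.comp_apply, Colim.move_mk, Colim.move_mk, Colim.move_mk]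
  exact Colim.mk_congr
    (Set.image_comp (g : Equiv.Perm (CAlg S r)) (h : Equiv.Perm (CAlg S r)) A.1) fun _ _ _ => rfl

variable (S r L) in
/-- The action of `V_r(Σ)` on the colimit: `g` sends the class of `f : A → L` to the class of
`f ∘ g⁻¹ : gA → L`. -/
def Colim.action : V S r →* MulAut (Colim S r L) where
  toFun g := MonoidHom.toMulEquiv (Colim.move g) (Colim.move g⁻¹)
    (by rw [← Colim.move_mul, inv_mul_cancel, Colim.move_one])
    (by rw [← Colim.move_mul, mul_inv_cancel, Colim.move_one])
  map_one' := MulEquiv.ext fun x => DFunLike.congr_fun Colim.move_one x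
  map_mul' g h := MulEquiv.ext fun x => DFunLike.congr_fun (Colim.move_mul g h) x

end Groups

section FiniteSubgroups

/-- A permutation representation on a non-empty set `{1, …, m}` that is transitive. -/
def IsTransRep {Q : Type} [Group Q] {m : ℕ} (ψ : Q →* Equiv.Perm (Fin m)) : Prop :=
  0 < m ∧ ∀ k l, ∃ q, ψ q k = l

/-- Equivalence of permutation representations. -/
def EquivRep {Q : Type} [Group Q] {m m' : ℕ} (ψ : Q →* Equiv.Perm (Fin m))
    (ψ' : Q →* Equiv.Perm (Fin m')) : Prop :=
  ∃ e : Fin m ≃ Fin m', ∀ q k, e (ψ q k) = ψ' q (e k)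

/-- `φ_1, …, φ_t` are the transitive permutation representations of `Q`, each listed exactly once
up to equivalence. -/
def IsCompleteList {Q : Type} [Group Q] {t : ℕ} {m : Fin t → ℕ}
    (φ : ∀ i, Q →* Equiv.Perm (Fin (m i))) : Prop :=
  (∀ i, IsTransRep (φ i)) ∧
  ∀ (m' : ℕ) (ψ : Q →* Equiv.Perm (Fin m')), IsTransRep ψ → ∃! i, EquivRep (φ i) ψ

variable {S : CantorSystem} {r : ℕ} (Q : Subgroup (V S r))

/-- `Y` is a basis that is setwise fixed by `Q`. -/
def IsFixedBasis (Y : Set (CAlg S r)) : Prop :=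
  IsBasis S Y ∧ ∀ q : Q, (fun y => q • y) '' Y = Y

/-- `Y` has minimal cardinality among the bases that are setwise fixed by `Q`. -/
def IsMinFixedBasis (Y : Set (CAlg S r)) : Prop :=
  IsFixedBasis Q Y ∧ ∀ Y', IsFixedBasis Q Y' → Y.encard ≤ Y'.encard

/-- `O` is a `Q`-set of type `ψ`. -/
def HasType {m : ℕ} (ψ : Q →* Equiv.Perm (Fin m)) (O : Set (CAlg S r)) : Prop :=
  ∃ e : Fin m ≃ O, ∀ (q : Q) (k : Fin m), (e (ψ q k) : CAlg S r) = q • (e k : CAlg S r)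

/-- The number of `Q`-orbits of type `ψ` in `Y`. -/
noncomputable def orbitCount {m : ℕ} (ψ : Q →* Equiv.Perm (Fin m)) (Y : Set (CAlg S r)) : ℕ :=
  Set.ncard {O : Set (CAlg S r) | (∃ y ∈ Y, O = MulAction.orbit Q y) ∧ HasType Q ψ O}

end FiniteSubgroups

/-- The centraliser `C_{S_m}(ψ(Q))`. -/
abbrev centRep {Q : Type} [Group Q] {m : ℕ} (ψ : Q →* Equiv.Perm (Fin m)) :
    Subgroup (Equiv.Perm (Fin m)) :=
  Subgroup.centralizer (ψ.range : Set (Equiv.Perm (Fin m)))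

/-- The semidirect product `colim (U_l(Σ), L) ⋊ V_l(Σ)`. -/
abbrev GFactor (S : CantorSystem) (l : ℕ) (L : Type) [Group L] : Type :=
  Colim S l L ⋊[Colim.action S l L] V S l

end CantorAlg

/-! For r > 0 validity enters only through one consequence: the laws have a nontrivial model
(`HasModel`). Sending a basis into such a model, with values that differ at one element, shows that
distinct basis elements have no common descendant, that an expansion strictly enlarges a finite
basis, and that no basis properly contains another. Boundedness, looked at below a single generator,
says that any two trees of expansions have a common refinement (`Confluent`). Neither consequence
mentions r, so both are available for the ranks r_i, where validity and boundedness are not assumed: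
in every rank any two bases have a common expansion (`IsBasis.exists_le_le`), the admissible sets
are exactly the bases, and V is the full automorphism group.

In rank r boundedness also gives least upper bounds. If Y ≤ qZ for all q in the finite group Q, the
least upper bound T of all qZ satisfies T ≤ qT, and equal cardinality forces T = qT
(`exists_le_invariant`). This produces invariant bases, and invariant bases above a given one.

The orbits of type φ_i in an invariant basis Y exhibit U_r as the free product, over all i, of m_i
copies of U_{r_i}, and Q permutes these copies through φ_i (`Columns`). A map f : A → L_i acts by
permuting the copies of each a ∈ A by f a; this is compatible with expansion, hence defines an
action of K_i. The group V_{r_i} acts simultaneously on all copies, and together they give an action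
of the product of the G_i that is faithful and commutes with Q. Conversely, if g centralises Q,
choose an invariant T above Y and gY. Then T and g⁻¹T are both unions of copies of bases A_i and
A'_i of U_{r_i}, and g carries the column of copies of each a ∈ A'_i onto the column of some b ∈ A_i
by a permutation in L_i; this is precisely an element of the product (`range_totalHom`).

If r_i > d, contractions and expansions give U_{r_i} a basis with fewer than r_i elements; using it
in every copy contradicts the minimality of Y. -/

namespace CantorAlg

/-! ### Trees of expansions and simultaneous refinement -/

section Trees

/-- Finite rooted trees whose inner nodes are coloured and have as many children as the arity of
their colour. -/
inductive Tree (S : CantorSystem) : Type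
  | leaf : Tree S
  | node : ∀ i : Fin S.s, (Fin (S.n i) → Tree S) → Tree S

variable {S : CantorSystem} {U M : Type} [OmegaAlgebra S U] [OmegaAlgebra S M]

theorem IsHom.id : IsHom S (id : U → U) := ⟨fun _ _ => rfl, fun _ _ _ => rfl⟩

/-- The descendants of `u` at the leaves of a tree. -/
def Tree.leaves : Tree S → U → Set U
  | .leaf, u => {u}
  | .node i t, u => ⋃ j, (t j).leaves (OmegaAlgebra.alpha (S := S) i j u)

/-- Replace every leaf `b` of the tree, placed at the root `u`, by the tree `ρ b`. -/
def Tree.graft (ρ : U → Tree S) : Tree S → U → Tree S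
  | .leaf, u => ρ u
  | .node i t, u => .node i fun j => (t j).graft ρ (OmegaAlgebra.alpha (S := S) i j u)

theorem Tree.leaves_graft (ρ : U → Tree S) (τ : Tree S) (u : U) :
    (τ.graft ρ u).leaves u = ⋃ b ∈ τ.leaves u, (ρ b).leaves b := by
  induction τ generalizing u with
  | leaf => simp [graft, leaves]
  | node i t ih =>
    simp only [graft, leaves, ih, Set.mem_iUnion, Set.iUnion_exists]
    exact Set.iUnion_comm _

theorem Tree.image_leaves {h : U → M} (hh : IsHom S h) (τ : Tree S) (u : U) :
    h '' τ.leaves u = τ.leaves (h u) := by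
  induction τ generalizing u with
  | leaf => simp [leaves]
  | node i t ih => simp [leaves, ih, Set.image_iUnion, hh.2]

theorem Tree.leaves_finite (τ : Tree S) (u : U) : (τ.leaves u).Finite := by
  induction τ generalizing u with
  | leaf => simp [leaves]
  | node i t ih => exact Set.finite_iUnion fun j => ih j _

theorem Tree.hom_eq_of_mem_leaves {h k : U → M} (hh : IsHom S h) (hk : IsHom S k) {τ : Tree S}
    {a b : U} (hb : b ∈ τ.leaves a) (hab : h a = k a) : h b = k b := by
  induction τ generalizing a with
  | leaf => obtain rfl : b = a := hb; exact hab
  | node i t ih =>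
    obtain ⟨j, hj⟩ := Set.mem_iUnion.1 hb
    exact ih j hj (by rw [hh.2, hk.2, hab])

/-- The value at the root can be chosen so as to prescribe the value at one given leaf. -/
theorem Tree.exists_root (hM : Satisfies S M) {τ : Tree S} {a b : U} (hb : b ∈ τ.leaves a)
    (y : M) : ∃ x : M, ∀ h : U → M, IsHom S h → h a = x → h b = y := by
  induction τ generalizing a with
  | leaf => obtain rfl : b = a := hb; exact ⟨y, fun h _ hy => hy⟩
  | node i t ih =>
    obtain ⟨j, hj⟩ := Set.mem_iUnion.1 hb
    obtain ⟨x, hx⟩ := ih j hj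
    -- The child containing `b` must receive `x`; the values at the other children are irrelevant,
    -- so the constant tuple serves.
    refine ⟨OmegaAlgebra.lam (S := S) i fun _ => x, fun h hh hha => hx h hh ?_⟩
    rw [hh.2, hha, hM.2.1]

variable (S) in
/-- The set of descendants of `a`. -/
def cone (a : U) : Set U := {b | ∃ τ : Tree S, b ∈ τ.leaves a}

theorem leaves_subset_cone (τ : Tree S) (a : U) : τ.leaves a ⊆ cone S a := fun _ h => ⟨τ, h⟩

theorem self_mem_cone (a : U) : a ∈ cone S a := ⟨.leaf, rfl⟩

theorem cone_trans {a b c : U} (hb : b ∈ cone S a) (hc : c ∈ cone S b) : c ∈ cone S a := by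
  obtain ⟨τ, hτ⟩ := hb
  obtain ⟨σ, hσ⟩ := hc
  refine ⟨τ.graft (fun _ => σ) a, ?_⟩
  rw [Tree.leaves_graft]
  exact Set.mem_biUnion hτ hσ

theorem alpha_mem_cone (i : Fin S.s) (j : Fin (S.n i)) (a : U) :
    OmegaAlgebra.alpha (S := S) i j a ∈ cone S a :=
  ⟨.node i fun _ => .leaf, Set.mem_iUnion.2 ⟨j, rfl⟩⟩

variable (S) in
/-- `B` is obtained from `A` by replacing each element by its descendants at the leaves of a
tree. -/
def Refine (A B : Set U) : Prop := ∃ τ : U → Tree S, B = ⋃ a ∈ A, (τ a).leaves a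

theorem Refine.refl (A : Set U) : Refine S A A := ⟨fun _ => .leaf, by simp [Tree.leaves]⟩

theorem Refine.trans {A B C : Set U} (h₁ : Refine S A B) (h₂ : Refine S B C) : Refine S A C := by
  obtain ⟨τ, rfl⟩ := h₁
  obtain ⟨σ, rfl⟩ := h₂
  refine ⟨fun a => (τ a).graft σ a, ?_⟩
  simp only [Tree.leaves_graft, Set.biUnion_iUnion]

open Classical in
theorem refine_expand {A : Set U} {a : U} (ha : a ∈ A) (i : Fin S.s) :
    Refine S A (expand S A a i) := by
  refine ⟨fun c => if c = a then .node i fun _ => .leaf else .leaf, ?_⟩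
  ext x
  simp only [expand, Set.mem_union, Set.mem_iUnion, Set.mem_sdiff, Set.mem_singleton_iff,
    Set.mem_range, exists_prop]
  constructor
  · rintro (⟨hx, hxa⟩ | ⟨j, rfl⟩)
    · exact ⟨x, hx, by simp [hxa, Tree.leaves]⟩
    · exact ⟨a, ha, by simp [Tree.leaves]⟩
  · rintro ⟨c, hc, hx⟩
    by_cases hca : c = a
    · subst hca
      simp only [if_true, Tree.leaves, Set.mem_iUnion, Set.mem_singleton_iff] at hx
      exact Or.inr (hx.imp fun _ h => h.symm)
    · simp only [if_neg hca, Tree.leaves, Set.mem_singleton_iff] at hx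
      subst hx
      exact Or.inl ⟨hc, hca⟩

theorem Le.refine {A B : Set U} (h : Le S A B) : Refine S A B := by
  induction h with
  | refl => exact Refine.refl A
  | tail _ h ih =>
    obtain ⟨a, ha, i, rfl⟩ := h
    exact ih.trans (refine_expand ha i)

theorem Refine.exists_leaves_subset {A B : Set U} (h : Refine S A B) {u : U} {τ : Tree S}
    (hτ : τ.leaves u ⊆ A) : ∃ σ : Tree S, σ.leaves u ⊆ B := by
  obtain ⟨ρ, rfl⟩ := h
  refine ⟨τ.graft ρ u, ?_⟩
  rw [Tree.leaves_graft]
  exact Set.biUnion_subset_biUnion_left hτ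

theorem Refine.finite {A B : Set U} (h : Refine S A B) (hA : A.Finite) : B.Finite := by
  obtain ⟨ρ, rfl⟩ := h
  exact hA.biUnion fun a _ => (ρ a).leaves_finite a

end Trees

/-! ### Bases when the laws have a nontrivial model -/

section Bases

/-- Some non-trivial algebra satisfies the laws. -/
def HasModel (S : CantorSystem) : Prop :=
  ∃ (N : Type) (_ : OmegaAlgebra S N), Satisfies S N ∧ Nontrivial N

variable {S : CantorSystem} {U M : Type} [OmegaAlgebra S U] [OmegaAlgebra S M]

theorem IsBasis.hom_ext {A : Set U} (hA : IsBasis S A) (hM : Satisfies S M) {h k : U → M}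
    (hh : IsHom S h) (hk : IsHom S k) (hhk : ∀ a ∈ A, h a = k a) : h = k :=
  (hA M hM fun a => h a).unique ⟨hh, fun _ => rfl⟩ ⟨hk, fun a => (hhk a a.2).symm⟩

theorem IsBasis.exists_hom {A : Set U} (hA : IsBasis S A) (hM : Satisfies S M) (θ : U → M) :
    ∃ h : U → M, IsHom S h ∧ ∀ a ∈ A, h a = θ a := by
  obtain ⟨h, ⟨hh, hθ⟩, -⟩ := hA M hM fun a => θ a
  exact ⟨h, hh, fun a ha => hθ ⟨a, ha⟩⟩

theorem IsBasis.mk_of_exists_ext {A : Set U}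
    (h₁ : ∀ (N : Type) [OmegaAlgebra S N], Satisfies S N → ∀ θ : A → N,
      ∃ h : U → N, IsHom S h ∧ ∀ a : A, h a = θ a)
    (h₂ : ∀ (N : Type) [OmegaAlgebra S N], Satisfies S N → ∀ h k : U → N, IsHom S h → IsHom S k →
      (∀ a ∈ A, h a = k a) → h = k) : IsBasis S A := by
  intro N _ hN θ
  obtain ⟨h, hh, hθ⟩ := h₁ N hN θ
  exact ⟨h, ⟨hh, hθ⟩, fun k hk => h₂ N hN k h hk.1 hh fun a ha => by
    rw [hk.2 ⟨a, ha⟩, hθ ⟨a, ha⟩]⟩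

open Classical in
/-- Two homomorphisms that separate one element of a basis and agree on the others. -/
theorem IsBasis.exists_separating (hS : HasModel S) {A : Set U} (hA : IsBasis S A) {τ : Tree S}
    {a b : U} (hb : b ∈ τ.leaves a) :
    ∃ (N : Type) (_ : OmegaAlgebra S N) (h k : U → N), Satisfies S N ∧ IsHom S h ∧ IsHom S k ∧
      (∀ c ∈ A, c ≠ a → h c = k c) ∧ (a ∈ A → h b ≠ k b) := by
  obtain ⟨N, _, hN, y, y', hy⟩ := hS
  obtain ⟨x, hx⟩ := Tree.exists_root hN hb y
  obtain ⟨x', hx'⟩ := Tree.exists_root hN hb y'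
  obtain ⟨h, hh, hh'⟩ := hA.exists_hom hN fun c => if c = a then x else y
  obtain ⟨k, hk, hk'⟩ := hA.exists_hom hN fun c => if c = a then x' else y
  refine ⟨N, _, h, k, hN, hh, hk, fun c hc hca => by simp [hh' c hc, hk' c hc, hca], fun ha => ?_⟩
  rw [hx h hh (by simp [hh' a ha]), hx' k hk (by simp [hk' a ha])]
  exact hy

/-- Otherwise two homomorphisms separated at `b` could agree on all of `A` except `a`, hence at
`a'`, hence at its descendant `b`. -/
theorem IsBasis.eq_of_mem_cone (hS : HasModel S) {A : Set U} (hA : IsBasis S A) {a a' b : U}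
    (ha : a ∈ A) (ha' : a' ∈ A) (hb : b ∈ cone S a) (hb' : b ∈ cone S a') : a = a' := by
  obtain ⟨τ, hτ⟩ := hb
  obtain ⟨σ, hσ⟩ := hb'
  by_contra hne
  obtain ⟨N, _, h, k, hN, hh, hk, hhk, hb⟩ := hA.exists_separating hS hτ
  exact hb ha (Tree.hom_eq_of_mem_leaves hh hk hσ (hhk a' ha' (Ne.symm hne)))

theorem IsBasis.eq_of_subset (hS : HasModel S) {A B : Set U} (hA : IsBasis S A)
    (hB : IsBasis S B) (hAB : A ⊆ B) : A = B := by
  refine hAB.antisymm fun b hb => ?_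
  by_contra hbA
  obtain ⟨N, _, h, k, hN, hh, hk, hhk, hne⟩ :=
    hB.exists_separating hS (τ := .leaf) (a := b) (b := b) rfl
  refine hne hb (congrFun (hA.hom_ext hN hh hk fun a ha => hhk a (hAB ha) ?_) b)
  rintro rfl
  exact hbA ha

theorem IsBasis.alpha_injective (hS : HasModel S) {A : Set U} (hA : IsBasis S A) {a : U}
    (ha : a ∈ A) (i : Fin S.s) :
    Function.Injective fun j => OmegaAlgebra.alpha (S := S) i j a := by
  classical
  intro j k hjk
  by_contra hne
  obtain ⟨N, _, hN, y, y', hy⟩ := hS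
  obtain ⟨h, hh, hh'⟩ := hA.exists_hom hN fun _ =>
    OmegaAlgebra.lam (S := S) i fun l => if l = j then y else y'
  have := congrArg h hjk
  simp only [hh.2, hh' a ha, hN.2.1, if_true, if_neg (Ne.symm hne)] at this
  exact hy this

theorem IsBasis.eq_of_alpha_mem (hS : HasModel S) {A : Set U} (hA : IsBasis S A) {a : U}
    (ha : a ∈ A) {i : Fin S.s} {j : Fin (S.n i)} (h : OmegaAlgebra.alpha (S := S) i j a ∈ A) :
    OmegaAlgebra.alpha (S := S) i j a = a :=
  hA.eq_of_mem_cone hS h ha (self_mem_cone _) (alpha_mem_cone i j a)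

theorem IsBasis.alpha_ne (hS : HasModel S) {A : Set U} (hA : IsBasis S A) {a : U}
    (ha : a ∈ A) (i : Fin S.s) (j : Fin (S.n i)) : OmegaAlgebra.alpha (S := S) i j a ≠ a := by
  classical
  intro heq
  have hlt := S.one_lt i
  obtain ⟨k, hk⟩ : ∃ k : Fin (S.n i), k ≠ j := by
    have : Nontrivial (Fin (S.n i)) := Fin.nontrivial_iff_two_le.2 hlt
    exact exists_ne j
  have hS' := hS
  obtain ⟨N, _, hN, y, y', hy⟩ := hS
  obtain ⟨h, hh, hh'⟩ := hA.exists_hom hN fun _ =>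
    OmegaAlgebra.lam (S := S) i fun l => if l = j then y else y'
  obtain ⟨h₂, hh₂, hh₂'⟩ := hA.exists_hom hN fun _ =>
    OmegaAlgebra.lam (S := S) i fun _ => y
  have e₁ := congrArg h heq
  have e₂ := congrArg h₂ heq
  simp only [hh.2, hh' a ha, hN.2.1, if_true] at e₁
  simp only [hh₂.2, hh₂' a ha, hN.2.1] at e₂
  -- If the `j`-th child of `a` were `a`, both homomorphisms would send `a` to `y`; so the two
  -- chosen tuples would have the same `lam`, although they differ in position `k`.
  have := congrArg (OmegaAlgebra.alpha (S := S) i k) (e₁.symm.trans e₂)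
  simp only [hN.2.1, if_neg hk] at this
  exact hy this.symm

theorem IsBasis.alpha_not_mem (hS : HasModel S) {A : Set U} (hA : IsBasis S A) {a : U}
    (ha : a ∈ A) (i : Fin S.s) (j : Fin (S.n i)) : OmegaAlgebra.alpha (S := S) i j a ∉ A :=
  fun h => hA.alpha_ne hS ha i j (hA.eq_of_alpha_mem hS ha h)

-- Prescribing values on the children of `a` amounts to prescribing the value at `a`, since each
-- `lam` is inverse to the tuple of its `alpha`s.
open Classical in
theorem IsBasis.expand (hU : Satisfies S U) {A : Set U} (hA : IsBasis S A)
    {a : U} (ha : a ∈ A) (i : Fin S.s) : IsBasis S (expand S A a i) := by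
  refine .mk_of_exists_ext (fun N _ hN θ => ?_) fun N _ hN h k hh hk hhk => ?_
  · have hmem : ∀ j, OmegaAlgebra.alpha (S := S) i j a ∈ CantorAlg.expand S A a i :=
      fun j => Or.inr ⟨j, rfl⟩
    obtain ⟨h, hh, hh'⟩ := hA.exists_hom hN fun c =>
      if c = a then OmegaAlgebra.lam (S := S) i fun j => θ ⟨_, hmem j⟩
      else if hc : c ∈ CantorAlg.expand S A a i then θ ⟨c, hc⟩
      else OmegaAlgebra.lam (S := S) i fun j => θ ⟨_, hmem j⟩
    refine ⟨h, hh, ?_⟩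
    rintro ⟨x, (⟨hx, hxa⟩ | ⟨j, rfl⟩)⟩
    · exact (hh' x hx).trans ((if_neg hxa).trans (dif_pos (Or.inl ⟨hx, hxa⟩)))
    · simp only [hh.2, hh' a ha, if_true, hN.2.1]
  · refine hA.hom_ext hN hh hk fun c hc => ?_
    by_cases hca : c = a
    · subst hca
      rw [← hU.1 i c, hh.1, hk.1]
      congr 1
      funext j
      exact hhk _ (Or.inr ⟨j, rfl⟩)
    · exact hhk c (Or.inl ⟨hc, hca⟩)

theorem IsBasis.contract {A : Set U} (hU : Satisfies S U) (hA : IsBasis S A) {i : Fin S.s}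
    {b : Fin (S.n i) → U} (hb : Function.Injective b) (hbA : Set.range b ⊆ A) :
    IsBasis S ((A \ Set.range b) ∪ {OmegaAlgebra.lam (S := S) i b}) := by
  classical
  refine .mk_of_exists_ext (fun N _ hN θ => ?_) fun N _ hN h k hh hk hhk => ?_
  · have hl : OmegaAlgebra.lam (S := S) i b ∈
        (A \ Set.range b) ∪ {OmegaAlgebra.lam (S := S) i b} := Or.inr rfl
    obtain ⟨h, hh, hh'⟩ := hA.exists_hom hN fun c =>
      if hc : c ∈ Set.range b then OmegaAlgebra.alpha (S := S) i hc.choose (θ ⟨_, hl⟩)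
      else if hc : c ∈ (A \ Set.range b) ∪ {OmegaAlgebra.lam (S := S) i b} then θ ⟨c, hc⟩
      else θ ⟨_, hl⟩
    refine ⟨h, hh, fun c => ?_⟩
    obtain ⟨x, hx⟩ := c
    rcases id hx with hx' | hx'
    · exact (hh' x hx'.1).trans ((dif_neg hx'.2).trans (dif_pos hx))
    · obtain rfl : x = OmegaAlgebra.lam (S := S) i b := hx'
      have hj : ∀ j, h (b j) = OmegaAlgebra.alpha (S := S) i j (θ ⟨_, hl⟩) := fun j => by
        have hr : b j ∈ Set.range b := ⟨j, rfl⟩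
        rw [hh' _ (hbA hr), dif_pos hr, hb hr.choose_spec]
      show h (OmegaAlgebra.lam (S := S) i b) = _
      rw [hh.1]
      simp only [hj]
      exact hN.1 i _
  · refine hA.hom_ext hN hh hk fun c hc => ?_
    by_cases hcb : c ∈ Set.range b
    · obtain ⟨j, rfl⟩ := hcb
      rw [← hU.2.1 i b j, hh.2, hk.2, hhk _ (Or.inr rfl)]
    · exact hhk c (Or.inl ⟨hc, hcb⟩)

theorem IsBasis.of_le (hU : Satisfies S U) {A B : Set U} (hA : IsBasis S A) (h : Le S A B) :
    IsBasis S B := by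
  induction h with
  | refl => exact hA
  | tail _ h ih =>
    obtain ⟨a, ha, i, rfl⟩ := h
    exact ih.expand hU ha i

theorem IsBasis.disjoint_range_alpha (hS : HasModel S) {A : Set U} (hA : IsBasis S A) {a : U}
    (ha : a ∈ A) (i : Fin S.s) :
    Disjoint (A \ {a}) (Set.range fun j => OmegaAlgebra.alpha (S := S) i j a) := by
  rw [Set.disjoint_left]
  rintro _ ⟨hx, -⟩ ⟨j, rfl⟩
  exact hA.alpha_not_mem hS ha i j hx

theorem IsBasis.simpleContraction_expand (hS : HasModel S) (hU : Satisfies S U) {A : Set U}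
    (hA : IsBasis S A) {a : U} (ha : a ∈ A) (i : Fin S.s) :
    SimpleContraction S (CantorAlg.expand S A a i) A := by
  refine ⟨i, _, hA.alpha_injective hS ha i, Set.subset_union_right, ?_⟩
  rw [hU.1, CantorAlg.expand, Set.union_sdiff_right,
    (hA.disjoint_range_alpha hS ha i).sdiff_eq_left, Set.sdiff_union_self, Set.union_singleton,
    Set.insert_eq_of_mem ha]

theorem IsBasis.encard_expand (hS : HasModel S) {A : Set U} (hA : IsBasis S A) {a : U}
    (ha : a ∈ A) (i : Fin S.s) : (CantorAlg.expand S A a i).encard + 1 = A.encard + S.n i := by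
  rw [CantorAlg.expand, Set.encard_union_eq (hA.disjoint_range_alpha hS ha i), add_right_comm,
    Set.encard_sdiff_singleton_add_one ha, ← Set.image_univ,
    (hA.alpha_injective hS ha i).encard_image, Set.encard_univ]
  simp

theorem IsBasis.encard_contract (hS : HasModel S) (hU : Satisfies S U) {A : Set U}
    (hA : IsBasis S A) {i : Fin S.s} {b : Fin (S.n i) → U} (hb : Function.Injective b)
    (hbA : Set.range b ⊆ A) :
    ((A \ Set.range b) ∪ {OmegaAlgebra.lam (S := S) i b}).encard + S.n i = A.encard + 1 := by
  have h : Disjoint (A \ Set.range b) {OmegaAlgebra.lam (S := S) i b} := by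
    rw [Set.disjoint_singleton_right]
    intro h
    refine hA.alpha_not_mem hS h.1 i ⟨0, zero_lt_one.trans (S.one_lt i)⟩ ?_
    rw [hU.2.1]
    exact hbA ⟨_, rfl⟩
  have hn : (Set.range b).encard = S.n i := by
    rw [← Set.image_univ, hb.encard_image, Set.encard_univ]
    simp
  rw [Set.encard_union_eq h, Set.encard_singleton, add_right_comm, ← hn,
    Set.encard_sdiff_add_encard_of_subset hbA]

/-- The elements of `s` are expanded one after another. The hypothesis on the trees ranges over all
bases because the ambient basis changes on the way; disjointness of cones ensures that the next
element is not also a leaf created earlier. -/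
theorem IsBasis.le_leaves_of_finite (hS : HasModel S) (hU : Satisfies S U) {A : Set U}
    (hA : IsBasis S A) {τ : U → Tree S} {s : Set U} (hs : s.Finite) (hsA : s ⊆ A)
    (hτ : ∀ a ∈ s, ∀ B : Set U, IsBasis S B → a ∈ B → Le S B ((B \ {a}) ∪ (τ a).leaves a)) :
    Le S A ((A \ s) ∪ ⋃ a ∈ s, (τ a).leaves a) := by
  induction s, hs using Set.Finite.induction_on with
  | empty =>
    simp only [Set.sdiff_empty, Set.biUnion_empty, Set.union_empty]
    exact .refl
  | @insert a s has hs ih =>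
    have hsA' := (Set.subset_insert a s).trans hsA
    have haA := hsA (Set.mem_insert a s)
    specialize ih hsA' fun c hc => hτ c (Set.mem_insert_of_mem a hc)
    set C := (A \ s) ∪ ⋃ a ∈ s, (τ a).leaves a with hC
    have hstep := hτ a (Set.mem_insert a s) C (hA.of_le hU ih) (Or.inl ⟨haA, has⟩)
    have hdisj : a ∉ ⋃ c ∈ s, (τ c).leaves c := by
      intro h
      obtain ⟨c, hc, hac⟩ := Set.mem_iUnion₂.1 h
      obtain rfl := hA.eq_of_mem_cone hS haA (hsA' hc) (self_mem_cone a)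
        (leaves_subset_cone _ _ hac)
      exact has hc
    have heq : (C \ {a}) ∪ (τ a).leaves a =
        (A \ insert a s) ∪ ⋃ c ∈ insert a s, (τ c).leaves c := by
      rw [hC, Set.union_sdiff_distrib, Set.sdiff_singleton_eq_self hdisj, Set.sdiff_sdiff,
        Set.union_singleton, Set.biUnion_insert, Set.union_assoc,
        Set.union_comm (⋃ c ∈ s, (τ c).leaves c)]
    exact ih.trans (heq ▸ hstep)

theorem IsBasis.le_leaves (hS : HasModel S) (hU : Satisfies S U) (τ : Tree S) {A : Set U}
    (hA : IsBasis S A) {a : U} (ha : a ∈ A) : Le S A ((A \ {a}) ∪ τ.leaves a) := by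
  induction τ generalizing A a with
  | leaf =>
    rw [Tree.leaves, Set.sdiff_union_self, Set.union_singleton, Set.insert_eq_of_mem ha]
    exact .refl
  | node i t ih =>
    have hinj := hA.alpha_injective hS ha i
    have : Nonempty (Fin (S.n i)) := ⟨⟨0, zero_lt_one.trans (S.one_lt i)⟩⟩
    have key := (hA.expand hU ha i).le_leaves_of_finite hS hU
      -- A child of `a` determines its index, so the subtree to be planted there can be read off
      -- from the child.
      (τ := fun x => t (Function.invFun (fun j => OmegaAlgebra.alpha (S := S) i j a) x))
      (s := Set.range fun j => OmegaAlgebra.alpha (S := S) i j a) (Set.finite_range _)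
      Set.subset_union_right (fun x _ B hB hx => ih _ hB hx)
    have heq : (CantorAlg.expand S A a i \ Set.range fun j => OmegaAlgebra.alpha (S := S) i j a) =
        A \ {a} := by
      rw [CantorAlg.expand, Set.union_sdiff_right,
        (hA.disjoint_range_alpha hS ha i).sdiff_eq_left]
    have hinv : ∀ j, Function.invFun (fun j => OmegaAlgebra.alpha (S := S) i j a)
        (OmegaAlgebra.alpha (S := S) i j a) = j := Function.leftInverse_invFun hinj
    rw [heq, Set.biUnion_range] at key
    simp only [hinv] at key
    exact .head ⟨a, ha, i, rfl⟩ key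

/-- With `Le.refine`, this identifies iterated expansion of a finite basis with simultaneous
refinement, which is easier to transport and to split. -/
theorem IsBasis.le_of_refine (hS : HasModel S) (hU : Satisfies S U) {A B : Set U}
    (hA : IsBasis S A) (hfin : A.Finite) (h : Refine S A B) : Le S A B := by
  obtain ⟨τ, rfl⟩ := h
  simpa using hA.le_leaves_of_finite hS hU (τ := τ) hfin subset_rfl
    fun a _ B hB ha => hB.le_leaves hS hU (τ a) ha

theorem Le.eq_or_encard_lt (hS : HasModel S) (hU : Satisfies S U) {A B : Set U}
    (hA : IsBasis S A) (hfin : A.Finite) (h : Le S A B) : A = B ∨ A.encard < B.encard := by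
  suffices B.Finite ∧ (A = B ∨ A.encard < B.encard) from this.2
  induction h with
  | refl => exact ⟨hfin, Or.inl rfl⟩
  | @tail B _ hB h ih =>
    obtain ⟨a, ha, i, rfl⟩ := h
    have hB' := hA.of_le hU hB
    have hcard := hB'.encard_expand hS ha i
    have hfin' := (refine_expand (S := S) ha i).finite ih.1
    refine ⟨hfin', Or.inr ?_⟩
    have hle : A.encard ≤ B.encard := ih.2.elim (fun h => h ▸ le_rfl) le_of_lt
    refine hle.trans_lt ?_
    rw [← ih.1.cast_ncard_eq, ← hfin'.cast_ncard_eq] at hcard ⊢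
    have hn := S.one_lt i
    norm_cast at hcard ⊢
    omega

theorem Le.image {h : Equiv.Perm U} (hh : h ∈ autGroup S U) {A B : Set U} (hAB : Le S A B) :
    Le S (h '' A) (h '' B) := by
  induction hAB with
  | refl => exact .refl
  | tail _ hstep ih =>
    obtain ⟨a, ha, i, rfl⟩ := hstep
    exact ih.tail ⟨h a, Set.mem_image_of_mem _ ha, i, image_expand hh _ a i⟩

end Bases

/-! ### The Cantor algebra as a free algebra; finiteness of its bases -/

section UniversalProperty

variable {S : CantorSystem} {N : Type} [OmegaAlgebra S N] {l : ℕ}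

/-- Evaluation of words. -/
def Word.eval {X : Type} (θ : X → N) : Word S X → N
  | .var x => θ x
  | .lam i v => OmegaAlgebra.lam (S := S) i fun j => (v j).eval θ
  | .alpha i j u => OmegaAlgebra.alpha (S := S) i j (u.eval θ)

theorem Cong.eval_eq {X : Type} (hN : Satisfies S N) (θ : X → N) {u v : Word S X}
    (h : Cong S X u v) : u.eval θ = v.eval θ := by
  induction h with
  | refl => rfl
  | symm _ ih => exact ih.symm
  | trans _ _ ih₁ ih₂ => exact ih₁.trans ih₂
  | lam i _ ih => simp only [Word.eval, ih]
  | alpha i j _ ih => simp only [Word.eval, ih]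
  | alpha_lam i u => exact hN.1 i _
  | lam_alpha i u j => exact hN.2.1 i _ j
  | pair i i' h p hp u w => exact hN.2.2 i i' h p hp _ w

variable (S l) in
/-- The free generators of the Cantor algebra. -/
def gen (k : Fin l) : CAlg S l := proj S l (.var k)

variable (S l) in
/-- The standard basis of the Cantor algebra. -/
abbrev gens : Set (CAlg S l) := Set.range (gen S l)

/-- The homomorphism with prescribed values on the free generators. -/
def CAlg.lift (hN : Satisfies S N) (θ : Fin l → N) : CAlg S l → N :=
  Quotient.lift (s := congSetoid S (Fin l)) (Word.eval θ) fun _ _ h => Cong.eval_eq hN θ h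

theorem proj_surjective (u : CAlg S l) : ∃ w, proj S l w = u := Quotient.exists_rep u

theorem proj_eq {u v : Word S (Fin l)} (h : Cong S (Fin l) u v) : proj S l u = proj S l v :=
  Quotient.sound (s := congSetoid S (Fin l)) h

theorem exists_proj {ι : Type} (v : ι → CAlg S l) :
    ∃ w : ι → Word S (Fin l), (fun j => proj S l (w j)) = v := by
  choose w hw using fun j => proj_surjective (v j)
  exact ⟨w, funext hw⟩

theorem CAlg.isHom_lift (hN : Satisfies S N) (θ : Fin l → N) : IsHom S (CAlg.lift hN θ) := by
  refine ⟨fun i v => ?_, fun i j u => ?_⟩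
  · obtain ⟨w, rfl⟩ := exists_proj v
    exact congrArg (CAlg.lift hN θ) ((isHom_proj S l).1 i w).symm
  · obtain ⟨w, rfl⟩ := proj_surjective u
    rfl

theorem CAlg.lift_gen (hN : Satisfies S N) (θ : Fin l → N) (k : Fin l) :
    CAlg.lift hN θ (gen S l k) = θ k := rfl

theorem CAlg.induction {P : CAlg S l → Prop} (hgen : ∀ k, P (gen S l k))
    (hlam : ∀ i (v : Fin (S.n i) → CAlg S l), (∀ j, P (v j)) → P (OmegaAlgebra.lam (S := S) i v))
    (halpha : ∀ i j u, P u → P (OmegaAlgebra.alpha (S := S) i j u)) (u : CAlg S l) : P u := by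
  obtain ⟨w, rfl⟩ := proj_surjective u
  induction w with
  | var k => exact hgen k
  | lam i v ih =>
    have := hlam i (fun j => proj S l (v j)) ih
    rwa [← (isHom_proj S l).1 i v] at this
  | alpha i j u ih => exact halpha i j _ ih

theorem CAlg.hom_ext {h k : CAlg S l → N} (hh : IsHom S h) (hk : IsHom S k)
    (hhk : ∀ x, h (gen S l x) = k (gen S l x)) : h = k := by
  funext u
  induction u using CAlg.induction with
  | hgen x => exact hhk x
  | hlam i v ih => rw [hh.1, hk.1]; simp only [ih]
  | halpha i j u ih => rw [hh.2, hk.2, ih]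

variable (S l) in
theorem satisfies_CAlg : Satisfies S (CAlg S l) := by
  refine ⟨fun i u => ?_, fun i v j => ?_, fun i i' h p hp u w => ?_⟩
  · obtain ⟨w, rfl⟩ := proj_surjective u
    exact ((isHom_proj S l).1 i fun j => Word.alpha i j w).symm.trans (proj_eq (.alpha_lam i w))
  · obtain ⟨w, rfl⟩ := exists_proj v
    rw [← (isHom_proj S l).1 i w]
    exact proj_eq (.lam_alpha i w j)
  · obtain ⟨v, rfl⟩ := proj_surjective u
    exact proj_eq (.pair i i' h p hp v w)

theorem gen_injective (hS : HasModel S) : Function.Injective (gen S l) := by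
  classical
  obtain ⟨N, _, hN, y, y', hy⟩ := hS
  intro k k' hkk
  by_contra hne
  have := congrArg (CAlg.lift hN fun x => if x = k then y else y') hkk
  rw [CAlg.lift_gen, CAlg.lift_gen, if_pos rfl, if_neg (Ne.symm hne)] at this
  exact hy this

theorem isBasis_gens : IsBasis S (gens S l) := by
  intro N _ hN θ
  refine ⟨CAlg.lift hN fun k => θ ⟨_, k, rfl⟩, ⟨CAlg.isHom_lift hN _, ?_⟩, fun k hk => ?_⟩
  · rintro ⟨_, k, rfl⟩
    rfl
  · refine CAlg.hom_ext hk.1 (CAlg.isHom_lift hN _) fun x => ?_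
    exact hk.2 ⟨_, x, rfl⟩

theorem encard_gens (hS : HasModel S) : (gens S l).encard = l := by
  rw [gens, ← Set.image_univ, (gen_injective hS).encard_image, Set.encard_univ]
  simp

variable {U : Type} [OmegaAlgebra S U]

/-- The elements with property `P` form a subalgebra satisfying the laws. Extending the inclusion of
`A` to a homomorphism into it, uniqueness makes this homomorphism a section of the inclusion, so the
subalgebra is everything. -/
theorem IsBasis.induction (hU : Satisfies S U) {A : Set U} (hA : IsBasis S A) {P : U → Prop}
    (hbase : ∀ a ∈ A, P a)
    (hlam : ∀ i (v : Fin (S.n i) → U), (∀ j, P (v j)) → P (OmegaAlgebra.lam (S := S) i v))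
    (halpha : ∀ i j u, P u → P (OmegaAlgebra.alpha (S := S) i j u)) (u : U) : P u := by
  let inst : OmegaAlgebra S {u // P u} :=
    ⟨fun i v => ⟨_, hlam i (fun j => (v j).1) fun j => (v j).2⟩, fun i j u => ⟨_, halpha i j _ u.2⟩⟩
  have hsat : Satisfies S {u // P u} :=
    ⟨fun i u => Subtype.ext (hU.1 i u.1), fun i v j => Subtype.ext (hU.2.1 i _ j),
      fun i i' h p hp u w => Subtype.ext (hU.2.2 i i' h p hp u.1 w)⟩
  obtain ⟨h, ⟨hh, hh'⟩, -⟩ := hA _ hsat fun a => ⟨a, hbase a a.2⟩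
  have hval : IsHom S (Subtype.val : {u // P u} → U) := ⟨fun _ _ => rfl, fun _ _ _ => rfl⟩
  have : Subtype.val ∘ h = id := hA.hom_ext hU (hval.comp hh) IsHom.id fun a ha => by
    simp [hh' ⟨a, ha⟩]
  have hu : (h u).1 = u := congrFun this u
  exact hu ▸ (h u).2

theorem IsBasis.exists_support (hU : Satisfies S U) {A : Set U} (hA : IsBasis S A) (u : U) :
    ∃ F ⊆ A, F.Finite ∧ ∀ (N : Type) [OmegaAlgebra S N], ∀ h k : U → N, IsHom S h → IsHom S k →
      (∀ a ∈ F, h a = k a) → h u = k u := by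
  induction u using hA.induction hU with
  | hbase a ha =>
    exact ⟨{a}, by simpa using ha, Set.finite_singleton a, fun N _ h k _ _ H => H a rfl⟩
  | hlam i v ih =>
    choose F hFA hF H using ih
    refine ⟨⋃ j, F j, Set.iUnion_subset hFA, Set.finite_iUnion hF, fun N _ h k hh hk hhk => ?_⟩
    rw [hh.1, hk.1]
    congr 1
    funext j
    exact H j N h k hh hk fun a ha => hhk a (Set.mem_iUnion.2 ⟨j, ha⟩)
  | halpha i j u ih =>
    obtain ⟨F, hFA, hF, H⟩ := ih
    exact ⟨F, hFA, hF, fun N _ h k hh hk hhk => by rw [hh.2, hk.2, H N h k hh hk hhk]⟩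

/-- Each generator depends on finitely many elements of `A`. A basis element outside their union
could be varied without changing any homomorphism on the generators. -/
theorem IsBasis.finite (hS : HasModel S) {A : Set (CAlg S l)} (hA : IsBasis S A) : A.Finite := by
  choose F hFA hF H using fun k => hA.exists_support (satisfies_CAlg S l) (gen S l k)
  refine (Set.finite_iUnion hF).subset fun a ha => ?_
  by_contra haF
  obtain ⟨N, _, h, k, hN, hh, hk, hhk, hne⟩ :=
    hA.exists_separating hS (τ := .leaf) (a := a) (b := a) rfl
  refine hne ha (congrFun (CAlg.hom_ext hh hk fun x => H x N h k hh hk fun c hc => ?_) a)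
  refine hhk c (hFA x hc) ?_
  rintro rfl
  exact haF (Set.mem_iUnion.2 ⟨x, hc⟩)

end UniversalProperty

/-! ### Common refinements in every rank -/

section Confluence

variable {S : CantorSystem} {l r : ℕ} {U : Type} [OmegaAlgebra S U]

/-- Any two trees have a common refinement. -/
def Confluent (S : CantorSystem) : Prop :=
  ∀ τ σ : Tree S, ∃ ρ ρ' : CAlg S 1 → Tree S,
    ⋃ b ∈ τ.leaves (gen S 1 0), (ρ b).leaves b = ⋃ b ∈ σ.leaves (gen S 1 0), (ρ' b).leaves b

theorem Le.admissible {A B : Set (CAlg S r)} (h : Le S A B) (hA : Admissible S r A) :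
    Admissible S r B := by
  induction h with
  | refl => exact hA
  | tail _ h ih => exact ih.tail (Or.inl h)

/-- Isolates what a refinement does below one basis element, so that confluence of trees can be
extracted from an upper bound of whole bases. -/
theorem sep_cone_eq (hS : HasModel S) {A : Set U} (hA : IsBasis S A) {a : U}
    (ha : a ∈ A) (τ : Tree S) (ρ : U → Tree S) :
    {t ∈ ⋃ b ∈ (A \ {a}) ∪ τ.leaves a, (ρ b).leaves b | t ∈ cone S a} =
      ⋃ b ∈ τ.leaves a, (ρ b).leaves b := by
  ext t
  simp only [Set.mem_ofPred_eq, Set.mem_iUnion, exists_prop]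
  constructor
  · rintro ⟨⟨b, hb | hb, htb⟩, ht⟩
    · exact absurd (hA.eq_of_mem_cone hS hb.1 ha (leaves_subset_cone _ _ htb) ht) hb.2
    · exact ⟨b, hb, htb⟩
  · rintro ⟨b, hb, htb⟩
    exact ⟨⟨b, Or.inr hb, htb⟩,
      cone_trans (leaves_subset_cone _ _ hb) (leaves_subset_cone _ _ htb)⟩

/-- Transports a grafting between algebras: `k` inverts `h` at `a`, hence at all descendants of `a`.
It moves confluence from rank r to rank one and from there below any basis element. -/
theorem image_graft_leaves {M : Type} [OmegaAlgebra S M] {h : U → M} {k : M → U}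
    (hh : IsHom S h) (hk : IsHom S k) {a : U} (ha : k (h a) = a) (τ : Tree S) (ρ : U → Tree S) :
    ⋃ b ∈ τ.leaves (h a), (ρ (k b)).leaves b = h '' ⋃ c ∈ τ.leaves a, (ρ c).leaves c := by
  rw [← Tree.image_leaves hh, Set.biUnion_image, Set.image_iUnion₂]
  refine Set.iUnion₂_congr fun c hc => ?_
  have : k (h c) = c := Tree.hom_eq_of_mem_leaves (hk.comp hh) IsHom.id hc ha
  rw [this, Tree.image_leaves hh]

theorem admissible_gens : Admissible S r (gens S r) := .refl

theorem confluent_of_bounded (hS : HasModel S) (hb : Bounded S r) (hr : 0 < r) :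
    Confluent S := by
  intro τ σ
  have hU := satisfies_CAlg S r
  have hX := isBasis_gens (S := S) (l := r)
  set a := gen S r ⟨0, hr⟩ with ha
  have haX : a ∈ gens S r := ⟨_, rfl⟩
  have h₁ := hX.le_leaves hS hU τ haX
  have h₂ := hX.le_leaves hS hU σ haX
  obtain ⟨T, ⟨-, hT₁, hT₂, -⟩, -⟩ := hb _ _ (h₁.admissible admissible_gens)
    (h₂.admissible admissible_gens) ⟨_, admissible_gens, h₁, h₂⟩
  obtain ⟨ρ, hρ⟩ := hT₁.refine
  obtain ⟨ρ', hρ'⟩ := hT₂.refine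
  have key : ⋃ b ∈ τ.leaves a, (ρ b).leaves b = ⋃ b ∈ σ.leaves a, (ρ' b).leaves b := by
    rw [← sep_cone_eq hS hX haX, ← sep_cone_eq hS hX haX, ← hρ, ← hρ']
  set h := CAlg.lift hU (fun _ : Fin 1 => a)
  set k := CAlg.lift (satisfies_CAlg S 1) (fun _ : Fin r => gen S 1 0)
  have hh : IsHom S h := CAlg.isHom_lift _ _
  have hk : IsHom S k := CAlg.isHom_lift _ _
  have hka : k a = gen S 1 0 := rfl
  have hhk : h (k a) = a := rfl
  refine ⟨fun b => ρ (h b), fun b => ρ' (h b), ?_⟩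
  rw [← hka, image_graft_leaves hk hh hhk, image_graft_leaves hk hh hhk, key]

/-- Every word can be expanded until its `lam`s are gone. Only the `alpha` case needs confluence: a
tree for `u` and the single expansion of colour `i` have a common refinement, and its part below the
`j`-th child is a tree for that child. -/
theorem Confluent.exists_tree (hc : Confluent S) (u : CAlg S l) :
    ∃ τ : Tree S, τ.leaves u ⊆ ⋃ k, cone S (gen S l k) := by
  induction u using CAlg.induction with
  | hgen k =>
    refine ⟨.leaf, ?_⟩
    rintro _ rfl
    exact Set.mem_iUnion.2 ⟨k, self_mem_cone _⟩
  | hlam i v ih =>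
    choose t ht using ih
    refine ⟨.node i t, ?_⟩
    simp only [Tree.leaves, (satisfies_CAlg S l).2.1]
    exact Set.iUnion_subset ht
  | halpha i j u ih =>
    obtain ⟨τ, hτ⟩ := ih
    obtain ⟨ρ, ρ', hρ⟩ := hc τ (.node i fun _ => .leaf)
    set h := CAlg.lift (satisfies_CAlg S l) (fun _ : Fin 1 => u)
    have hh : IsHom S h := CAlg.isHom_lift _ _
    have hu : h (gen S 1 0) = u := rfl
    refine ⟨ρ' (OmegaAlgebra.alpha (S := S) i j (gen S 1 0)), ?_⟩
    rw [← hu, ← hh.2, ← Tree.image_leaves hh]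
    rintro _ ⟨d, hd, rfl⟩
    have hd' : d ∈ ⋃ b ∈ τ.leaves (gen S 1 0), (ρ b).leaves b := by
      rw [hρ]
      exact Set.mem_biUnion (Set.mem_iUnion.2 ⟨j, rfl⟩) hd
    obtain ⟨b, hb, hdb⟩ := Set.mem_iUnion₂.1 hd'
    have hb' : h b ∈ τ.leaves u := by
      rw [← hu, ← Tree.image_leaves hh]
      exact Set.mem_image_of_mem h hb
    obtain ⟨k, hk⟩ := Set.mem_iUnion.1 (hτ hb')
    refine Set.mem_iUnion.2 ⟨k, cone_trans hk ⟨ρ b, ?_⟩⟩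
    rw [← Tree.image_leaves hh]
    exact Set.mem_image_of_mem h hdb

open Classical in
theorem Refine.directed (hS : HasModel S) (hc : Confluent S) (hU : Satisfies S U) {A B C : Set U}
    (hA : IsBasis S A) (hB : Refine S A B) (hC : Refine S A C) :
    ∃ D, Refine S B D ∧ Refine S C D := by
  obtain ⟨τ, rfl⟩ := hB
  obtain ⟨σ, rfl⟩ := hC
  choose ρ ρ' hρ using fun a => hc (τ a) (σ a)
  obtain ⟨k, hk, hkA⟩ := hA.exists_hom (satisfies_CAlg S 1) fun _ => gen S 1 0
  -- The refining tree at a leaf depends on the element of `A` above it and on its position below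
  -- that element. Disjoint cones recover the former, the homomorphism `k` to rank one the latter;
  -- outside the cones the value is irrelevant.
  let root : U → U := fun b => if h : ∃ a ∈ A, b ∈ cone S a then h.choose else b
  have hroot : ∀ a ∈ A, ∀ b ∈ cone S a, root b = a := fun a ha b hb => by
    have h : ∃ a ∈ A, b ∈ cone S a := ⟨a, ha, hb⟩
    simp only [root, dif_pos h]
    exact hA.eq_of_mem_cone hS h.choose_spec.1 ha h.choose_spec.2 hb
  have key : ∀ (τ : U → Tree S) (ρ : U → CAlg S 1 → Tree S),
      ⋃ b ∈ ⋃ a ∈ A, (τ a).leaves a, (ρ (root b) (k b)).leaves b =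
      ⋃ a ∈ A, ⋃ b ∈ (τ a).leaves a, (ρ a (k b)).leaves b := fun τ ρ => by
    simp only [Set.biUnion_iUnion]
    refine Set.iUnion₂_congr fun a ha => Set.iUnion₂_congr fun b hb => ?_
    rw [hroot a ha b (leaves_subset_cone _ _ hb)]
  refine ⟨_, ⟨fun b => ρ (root b) (k b), rfl⟩, fun b => ρ' (root b) (k b), ?_⟩
  rw [key, key]
  refine Set.iUnion₂_congr fun a ha => ?_
  set h := CAlg.lift hU (fun _ : Fin 1 => a)
  have hh : IsHom S h := CAlg.isHom_lift _ _
  have ha' : h (gen S 1 0) = a := rfl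
  have hkh : k (h (gen S 1 0)) = gen S 1 0 := hkA a ha
  rw [← ha', image_graft_leaves hh hk hkh, image_graft_leaves hh hk hkh, ha', hρ]

open Classical in
theorem Confluent.exists_cover (hS : HasModel S) (hc : Confluent S) {F : Set (CAlg S l)}
    (hF : F.Finite) (hFc : F ⊆ ⋃ k, cone S (gen S l k)) :
    ∃ Z, Refine S (gens S l) Z ∧ ∀ b ∈ F, ∃ τ : Tree S, τ.leaves b ⊆ Z := by
  induction F, hF using Set.Finite.induction_on with
  | empty => exact ⟨_, Refine.refl _, by simp⟩
  | @insert b F _ _ ih =>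
    obtain ⟨Z, hZ, hZF⟩ := ih ((Set.subset_insert b F).trans hFc)
    obtain ⟨k, σ, hσ⟩ := Set.mem_iUnion.1 (hFc (Set.mem_insert b F))
    have hZ' : Refine S (gens S l)
        (⋃ a ∈ gens S l, (if a = gen S l k then σ else .leaf).leaves a) := ⟨_, rfl⟩
    obtain ⟨D, hD, hD'⟩ := Refine.directed hS hc (satisfies_CAlg S l) isBasis_gens hZ hZ'
    refine ⟨D, hZ.trans hD, ?_⟩
    rintro c (rfl | hcF)
    · refine hD'.exists_leaves_subset (τ := .leaf) ?_
      rintro _ rfl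
      exact Set.mem_biUnion ⟨k, rfl⟩ (by simpa using hσ)
    · obtain ⟨τ, hτ⟩ := hZF c hcF
      exact hD.exists_leaves_subset hτ

theorem IsBasis.of_refine (hS : HasModel S) {A B : Set (CAlg S l)} (hA : IsBasis S A)
    (h : Refine S A B) : IsBasis S B :=
  hA.of_le (satisfies_CAlg S l) (hA.le_of_refine hS (satisfies_CAlg S l) (hA.finite hS) h)

/-- Refine `A` until it lies inside some refinement `Z` of the generators. Both are then bases, and
a basis contained in another equals it. -/
theorem IsBasis.exists_refine_gens (hS : HasModel S) (hc : Confluent S) {A : Set (CAlg S l)}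
    (hA : IsBasis S A) : ∃ Z, Refine S A Z ∧ Refine S (gens S l) Z := by
  choose τ hτ using fun u : CAlg S l => hc.exists_tree u
  have hAB : Refine S A (⋃ a ∈ A, (τ a).leaves a) := ⟨τ, rfl⟩
  obtain ⟨Z, hZ, H⟩ := hc.exists_cover hS (hAB.finite (hA.finite hS))
    (Set.iUnion₂_subset fun a _ => hτ a)
  have : Nonempty (Tree S) := ⟨.leaf⟩
  choose! ρ hρ using H
  have hAB' := hAB.trans ⟨ρ, rfl⟩
  refine ⟨Z, ?_, hZ⟩
  rwa [(hA.of_refine hS hAB').eq_of_subset hS (isBasis_gens.of_refine hS hZ)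
    (Set.iUnion₂_subset hρ)] at hAB'

theorem IsBasis.exists_le_le (hS : HasModel S) (hc : Confluent S) {A B : Set (CAlg S l)}
    (hA : IsBasis S A) (hB : IsBasis S B) : ∃ Z, IsBasis S Z ∧ Le S A Z ∧ Le S B Z := by
  have hU := satisfies_CAlg S l
  obtain ⟨Z₁, hA₁, hX₁⟩ := hA.exists_refine_gens hS hc
  obtain ⟨Z₂, hB₂, hX₂⟩ := hB.exists_refine_gens hS hc
  obtain ⟨D, hD₁, hD₂⟩ := Refine.directed hS hc hU isBasis_gens hX₁ hX₂
  have hA' := hA₁.trans hD₁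
  exact ⟨D, hA.of_refine hS hA', hA.le_of_refine hS hU (hA.finite hS) hA',
    hB.le_of_refine hS hU (hB.finite hS) (hB₂.trans hD₂)⟩

/-- A basis and the generators have a common expansion; undoing the expansions that start from the
basis gives contractions. -/
theorem admissible_iff_isBasis (hS : HasModel S) (hc : Confluent S) {A : Set (CAlg S r)} :
    Admissible S r A ↔ IsBasis S A := by
  have hU := satisfies_CAlg S r
  constructor
  · intro h
    induction h with
    | refl => exact isBasis_gens
    | tail _ h ih =>
      obtain ⟨a, ha, i, rfl⟩ | ⟨i, b, hb, hbA, rfl⟩ := h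
      · exact ih.expand hU ha i
      · exact ih.contract hU hb hbA
  · intro hA
    obtain ⟨Z, -, hAZ, hXZ⟩ := hA.exists_le_le hS hc isBasis_gens
    have hZ := hXZ.admissible admissible_gens
    clear hXZ
    induction hAZ with
    | refl => exact hZ
    | tail hAB h ih =>
      obtain ⟨a, ha, i, rfl⟩ := h
      exact ih (hZ.tail (Or.inr ((hA.of_le hU hAB).simpleContraction_expand hS hU ha i)))

theorem V_eq_autGroup (hS : HasModel S) (hc : Confluent S) : V S r = autGroup S (CAlg S r) := by
  refine (V_le_autGroup S r).antisymm fun g hg => Subgroup.subset_closure ⟨hg, gens S r,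
    g '' gens S r, admissible_gens, ?_, (g.injective.encard_image _).symm, rfl⟩
  exact (admissible_iff_isBasis hS hc).2 (isBasis_gens.image hg)

end Confluence

/-! ### Nontrivial models from validity, and bases fixed by a finite group -/

section FixedBases

variable {S : CantorSystem} {l r : ℕ}

theorem Valid.hasModel (hv : Valid S r) (hr : 0 < r) : HasModel S := by
  rcases Nat.eq_zero_or_pos S.s with h0 | hpos
  · have : IsEmpty (Fin S.s) := h0 ▸ Fin.isEmpty
    exact ⟨Bool, ⟨fun i => isEmptyElim i, fun i => isEmptyElim i⟩,
      ⟨fun i => isEmptyElim i, fun i => isEmptyElim i, fun i => isEmptyElim i⟩, inferInstance⟩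
  · refine ⟨CAlg S r, inferInstance, satisfies_CAlg S r, ?_⟩
    by_contra hnt
    rw [not_nontrivial_iff_subsingleton] at hnt
    let i : Fin S.s := ⟨0, hpos⟩
    let x : Word S (Fin r) := .var ⟨0, hr⟩
    have h := hv (expand S (Set.range Word.var) x i) (.single (Or.inl ⟨x, ⟨_, rfl⟩, i, rfl⟩))
    have hle : (expand S (Set.range Word.var) x i).encard ≤ 1 := by
      rw [← h, Set.encard_le_one_iff]
      exact fun a b _ _ => Subsingleton.elim a b
    rw [Set.encard_le_one_iff] at hle
    have hlt := S.one_lt i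
    have := hle (.alpha i ⟨0, zero_lt_one.trans hlt⟩ x) (.alpha i ⟨1, hlt⟩ x)
      (Or.inr ⟨_, rfl⟩) (Or.inr ⟨_, rfl⟩)
    simp at this

theorem exists_lub (hS : HasModel S) (hc : Confluent S) (hb : Bounded S r) {Y : Set (CAlg S r)}
    (hY : IsBasis S Y) {F : Set (Set (CAlg S r))} (hF : F.Finite)
    (hYF : ∀ Z ∈ F, Le S Y Z) :
    ∃ T, IsBasis S T ∧ Le S Y T ∧ (∀ Z ∈ F, Le S Z T) ∧
      ∀ T', IsBasis S T' → Le S Y T' → (∀ Z ∈ F, Le S Z T') → Le S T T' := by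
  induction F, hF using Set.Finite.induction_on with
  | empty => exact ⟨Y, hY, .refl, by simp, fun _ _ h _ => h⟩
  | @insert Z F _ _ ih =>
    obtain ⟨T, hT, hYT, hFT, hTT⟩ := ih fun Z hZ => hYF Z (Set.mem_insert_of_mem _ hZ)
    have hYZ := hYF Z (Set.mem_insert _ _)
    have hU := satisfies_CAlg S r
    have hadm : ∀ {A}, Admissible S r A ↔ IsBasis S A := admissible_iff_isBasis hS hc
    obtain ⟨D, ⟨hD, hTD, hZD, hDD⟩, -⟩ := hb T Z (hadm.2 hT) (hadm.2 (hY.of_le hU hYZ))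
      ⟨Y, hadm.2 hY, hYT, hYZ⟩
    refine ⟨D, hadm.1 hD, hYT.trans hTD, ?_, fun T' hT' hYT' h => ?_⟩
    · rintro Z' (rfl | hZ')
      · exact hZD
      · exact (hFT Z' hZ').trans hTD
    · exact hDD T' (hadm.2 hT') (hTT T' hT' hYT' fun Z hZ => h Z (Set.mem_insert_of_mem _ hZ))
        (h Z (Set.mem_insert _ _))

theorem smul_mem_autGroup {Q : Subgroup (V S r)} (q : Q) :
    MulAction.toPerm q ∈ autGroup S (CAlg S r) := V_le_autGroup S r q.1.2

theorem exists_le_invariant (hS : HasModel S) (hc : Confluent S) (hb : Bounded S r)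
    (Q : Subgroup (V S r)) [Finite Q] {Y Z : Set (CAlg S r)} (hY : IsBasis S Y)
    (hYZ : ∀ q : Q, Le S Y (MulAction.toPerm q '' Z)) :
    ∃ T, IsFixedBasis Q T ∧ Le S Z T := by
  have hU := satisfies_CAlg S r
  obtain ⟨T, hT, hYT, hFT, hTT⟩ := exists_lub hS hc hb hY
    (Set.finite_range fun q : Q => MulAction.toPerm q '' Z) (by rintro _ ⟨q, rfl⟩; exact hYZ q)
  have hZT : Le S Z T := by simpa using hFT _ ⟨1, rfl⟩
  refine ⟨T, ⟨hT, fun q => ?_⟩, hZT⟩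
  have hq := smul_mem_autGroup q
  -- `q` permutes the sets over which `T` is the least upper bound, so `qT` is an upper bound too.
  have key : Le S T (MulAction.toPerm q '' T) := by
    refine hTT _ (hT.image hq) ((hYZ q).trans (hZT.image hq)) ?_
    rintro _ ⟨q', rfl⟩
    have := (hFT _ ⟨q⁻¹ * q', rfl⟩).image hq
    rwa [← Set.image_comp, ← Equiv.coe_trans, show (MulAction.toPerm (q⁻¹ * q') : Equiv.Perm
      (CAlg S r)).trans (MulAction.toPerm q) = MulAction.toPerm q' from
        Equiv.ext fun x => by simp [mul_smul]] at this
  rcases key.eq_or_encard_lt hS hU hT (hT.finite hS) with h | h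
  · exact h.symm
  · rw [(Equiv.injective _).encard_image] at h
    exact absurd h (lt_irrefl _)

theorem exists_le_all (hS : HasModel S) (hc : Confluent S) {F : Set (Set (CAlg S l))}
    (hF : F.Finite) (hFb : ∀ A ∈ F, IsBasis S A) :
    ∃ Z, IsBasis S Z ∧ ∀ A ∈ F, Le S A Z := by
  induction F, hF using Set.Finite.induction_on with
  | empty => exact ⟨_, isBasis_gens, by simp⟩
  | @insert A F _ _ ih =>
    obtain ⟨Z, hZ, hFZ⟩ := ih fun A hA => hFb A (Set.mem_insert_of_mem _ hA)
    obtain ⟨D, hD, hZD, hAD⟩ := hZ.exists_le_le hS hc (hFb A (Set.mem_insert _ _))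
    refine ⟨D, hD, ?_⟩
    rintro A' (rfl | hA')
    · exact hAD
    · exact (hFZ A' hA').trans hZD

theorem exists_isFixedBasis (hS : HasModel S) (hc : Confluent S) (hb : Bounded S r)
    (Q : Subgroup (V S r)) [Finite Q] : ∃ T, IsFixedBasis Q T := by
  obtain ⟨Z, hZ, H⟩ := exists_le_all hS hc
    (Set.finite_range fun q : Q => MulAction.toPerm q '' gens S r)
    (by rintro _ ⟨q, rfl⟩; exact isBasis_gens.image (smul_mem_autGroup q))
  -- Since `Z` lies above every translate of the generators, every translate of `Z` lies above the
  -- generators.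
  obtain ⟨T, hT, -⟩ := exists_le_invariant hS hc hb Q isBasis_gens (Z := Z) fun q => by
    have := (H _ ⟨q⁻¹, rfl⟩).image (smul_mem_autGroup q)
    rwa [← Set.image_comp, ← Equiv.coe_trans, show (MulAction.toPerm q⁻¹ : Equiv.Perm
      (CAlg S r)).trans (MulAction.toPerm q) = 1 from
        Equiv.ext fun x => by simp, Equiv.Perm.coe_one, Set.image_id] at this
  exact ⟨T, hT⟩

theorem exists_isMinFixedBasis {Q : Subgroup (V S r)} (h : ∃ T, IsFixedBasis Q T) :
    ∃ Y, IsMinFixedBasis Q Y := by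
  obtain ⟨_, ⟨Y, hY, rfl⟩, hmin⟩ := wellFounded_lt.has_min
    (Set.encard '' {Y | IsFixedBasis Q Y}) (Set.Nonempty.image _ h)
  exact ⟨Y, hY, fun Y' hY' => not_lt.1 (hmin _ ⟨Y', hY', rfl⟩)⟩

end FixedBases

/-! ### Possible cardinalities of bases -/

section Sizes

variable {S : CantorSystem} {l : ℕ}

/-- Sizes of bases can be changed by `k`, as long as they remain positive. -/
def ShiftsBases (S : CantorSystem) (l : ℕ) (k : ℤ) : Prop :=
  ∀ A : Set (CAlg S l), IsBasis S A → 0 < (A.ncard : ℤ) → 0 < (A.ncard : ℤ) + k →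
    ∃ B : Set (CAlg S l), IsBasis S B ∧ (B.ncard : ℤ) = A.ncard + k

theorem ShiftsBases.add {k k' : ℤ} (h : ShiftsBases S l k) (h' : ShiftsBases S l k') :
    ShiftsBases S l (k + k') := by
  intro A hA h0 hpos
  -- The order of the two shifts is chosen so that the intermediate size stays positive.
  by_cases hk : 0 < (A.ncard : ℤ) + k
  · obtain ⟨B, hB, e⟩ := h A hA h0 hk
    obtain ⟨C, hC, e'⟩ := h' B hB (by omega) (by omega)
    exact ⟨C, hC, by omega⟩
  · obtain ⟨B, hB, e⟩ := h' A hA h0 (by omega)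
    obtain ⟨C, hC, e'⟩ := h B hB (by omega) (by omega)
    exact ⟨C, hC, by omega⟩

/-- The subgroup of all differences by which sizes of bases can be changed in both directions. -/
def shiftSubgroup (S : CantorSystem) (l : ℕ) : AddSubgroup ℤ where
  carrier := {k | ShiftsBases S l k ∧ ShiftsBases S l (-k)}
  zero_mem' := ⟨fun A hA _ _ => ⟨A, hA, by simp⟩, fun A hA _ _ => ⟨A, hA, by simp⟩⟩
  add_mem' h h' := ⟨h.1.add h'.1, by rw [neg_add]; exact h.2.add h'.2⟩
  neg_mem' h := ⟨h.2, by simpa using h.1⟩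

theorem arity_mem_shiftSubgroup (hS : HasModel S) (i : Fin S.s) :
    ((S.n i - 1 : ℕ) : ℤ) ∈ shiftSubgroup S l := by
  have hU := satisfies_CAlg S l
  have hn := S.one_lt i
  constructor
  · intro A hA h0 _
    obtain ⟨a, ha⟩ := (Set.ncard_pos (hA.finite hS)).1 (by exact_mod_cast h0)
    have hB := hA.expand hU ha i
    refine ⟨_, hB, ?_⟩
    have := hA.encard_expand hS ha i
    rw [← (hA.finite hS).cast_ncard_eq, ← (hB.finite hS).cast_ncard_eq] at this
    norm_cast at this
    omega
  · intro A hA h0 hpos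
    have hcard : S.n i ≤ A.ncard := by omega
    have hfin := hA.finite hS
    have : Fintype A := hfin.fintype
    obtain ⟨b⟩ : Nonempty (Fin (S.n i) ↪ A) := by
      refine Function.Embedding.nonempty_of_card_le ?_
      rwa [Fintype.card_fin, ← Nat.card_eq_fintype_card, Nat.card_coe_set_eq]
    have hinj : Function.Injective fun j => (b j : CAlg S l) :=
      Subtype.val_injective.comp b.injective
    have hbA : (Set.range fun j => (b j : CAlg S l)) ⊆ A := by
      rintro _ ⟨j, rfl⟩
      exact (b j).2
    have hB := hA.contract hU hinj hbA
    refine ⟨_, hB, ?_⟩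
    have := hA.encard_contract hS hU hinj hbA
    rw [← hfin.cast_ncard_eq, ← (hB.finite hS).cast_ncard_eq] at this
    norm_cast at this
    omega

/-- A subgroup of ℤ is cyclic, and a generator divides every n_i − 1, hence their gcd. -/
theorem d_mem_shiftSubgroup (hS : HasModel S) : (S.d : ℤ) ∈ shiftSubgroup S l := by
  obtain ⟨g, hg⟩ := Int.subgroup_cyclic (shiftSubgroup S l)
  have hmem : ∀ k, k ∈ shiftSubgroup S l ↔ g ∣ k := fun k => by
    rw [hg, ← AddSubgroup.zmultiples_eq_closure, Int.mem_zmultiples_iff]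
  rw [hmem, ← Int.natAbs_dvd_natAbs, Int.natAbs_natCast]
  refine Finset.dvd_gcd fun i _ => ?_
  rw [← Int.natCast_dvd_natCast, Int.natCast_natAbs, abs_dvd, ← hmem]
  exact arity_mem_shiftSubgroup hS i

theorem exists_isBasis_encard_lt (hS : HasModel S) (hs : 0 < S.s) (hl : S.d < l) :
    ∃ B : Set (CAlg S l), IsBasis S B ∧ B.encard < l := by
  have hfin : (gens S l).Finite := Set.finite_range _
  have hcard := encard_gens (S := S) (l := l) hS
  rw [← hfin.cast_ncard_eq] at hcard
  norm_cast at hcard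
  have hd : 0 < S.d := by
    rw [Nat.pos_iff_ne_zero, CantorSystem.d, Ne, Finset.gcd_eq_zero_iff]
    intro h
    have := h ⟨0, hs⟩ (Finset.mem_univ _)
    have := S.one_lt ⟨0, hs⟩
    omega
  obtain ⟨B, hB, e⟩ := (d_mem_shiftSubgroup (l := l) hS).2 (gens S l) isBasis_gens
    (by omega) (by omega)
  refine ⟨B, hB, ?_⟩
  rw [← (hB.finite hS).cast_ncard_eq]
  norm_cast
  omega

end Sizes

/-! ### Maps out of the colimit and normal forms of its elements -/

section Colimit

variable {S : CantorSystem} {r : ℕ} {L H : Type} [Group L] [Group H]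

/-- The homomorphism from the colimit given by a compatible family of homomorphisms. -/
def Colim.desc (F : ∀ A : Bases S r, (A.1 → L) →* H)
    (hF : ∀ (A : Bases S r) (a : CAlg S r) (ha : a ∈ A.1) (i : Fin S.s)
      (hB : IsBasis S (expand S A.1 a i)) (f : A.1 → L), F ⟨_, hB⟩ (diag ha i f) = F A f) :
    Colim S r L →* H :=
  PresentedGroup.toGroup (rels := {w | ColimRel S r L w}) (f := fun x => F x.1 x.2) (by
    intro w hw
    cases hw with
    | mul A f f' =>
      simp only [map_mul, map_inv, FreeGroup.lift_apply_of]
      rw [mul_inv_eq_one]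
    | edge A a ha i hB f =>
      simp only [map_mul, map_inv, FreeGroup.lift_apply_of]
      rw [mul_inv_eq_one, hF])

theorem Colim.desc_mk (F : ∀ A : Bases S r, (A.1 → L) →* H)
    (hF : ∀ (A : Bases S r) (a : CAlg S r) (ha : a ∈ A.1) (i : Fin S.s)
      (hB : IsBasis S (expand S A.1 a i)) (f : A.1 → L), F ⟨_, hB⟩ (diag ha i f) = F A f)
    (A : Bases S r) (f : A.1 → L) : Colim.desc F hF (Colim.mk A f) = F A f :=
  PresentedGroup.toGroup.of _

theorem Colim.mk_one (A : Bases S r) : Colim.mk A (1 : A.1 → L) = 1 := by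
  have := Colim.mk_mul A (1 : A.1 → L) 1
  rwa [mul_one, left_eq_mul] at this

theorem Colim.mk_inv (A : Bases S r) (f : A.1 → L) : Colim.mk A f⁻¹ = (Colim.mk A f)⁻¹ := by
  rw [eq_inv_iff_mul_eq_one, ← Colim.mk_mul, inv_mul_cancel, Colim.mk_one]

theorem Colim.exists_mk_eq_of_le (A : Bases S r) {Z : Set (CAlg S r)} (h : Le S A.1 Z)
    (f : A.1 → L) : ∃ (hZ : IsBasis S Z) (g : Z → L), Colim.mk A f = Colim.mk ⟨Z, hZ⟩ g := by
  induction h with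
  | refl => exact ⟨A.2, f, rfl⟩
  | tail _ h ih =>
    obtain ⟨a, ha, i, rfl⟩ := h
    obtain ⟨hZ, g, hg⟩ := ih
    have hB := hZ.expand (satisfies_CAlg S r) ha i
    exact ⟨hB, diag ha i g, by rw [hg, Colim.mk_edge ⟨_, hZ⟩ ha i hB]⟩

/-- Bases are directed under expansion, so the factors of a product can be pushed to one common
basis and multiplied there. -/
theorem Colim.exists_mk (hS : HasModel S) (hc : Confluent S) (x : Colim S r L) :
    ∃ (A : Bases S r) (f : A.1 → L), Colim.mk A f = x := by
  induction x using PresentedGroup.induction_on with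
  | _ w =>
    induction w using FreeGroup.induction_on with
    | C1 => exact ⟨⟨_, isBasis_gens⟩, 1, Colim.mk_one _⟩
    | of x => exact ⟨x.1, x.2, rfl⟩
    | inv_of x _ => exact ⟨x.1, x.2⁻¹, Colim.mk_inv _ _⟩
    | mul x y hx hy =>
      obtain ⟨A, f, hf⟩ := hx
      obtain ⟨B, g, hg⟩ := hy
      obtain ⟨Z, hZ, hAZ, hBZ⟩ := A.2.exists_le_le hS hc B.2
      obtain ⟨_, f', hf'⟩ := Colim.exists_mk_eq_of_le A hAZ f
      obtain ⟨_, g', hg'⟩ := Colim.exists_mk_eq_of_le B hBZ g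
      refine ⟨⟨Z, hZ⟩, f' * g', ?_⟩
      rw [Colim.mk_mul, ← hf', ← hg', hf, hg]
      exact (map_mul (PresentedGroup.mk _) x y).symm

end Colimit

/-! ### Free products of copies of Cantor algebras and their block automorphisms -/

/-- The permutation representation given by an action by functions. -/
def permHom {G X : Type} [Group G] (F : G → X → X) (h₁ : F 1 = id)
    (hmul : ∀ g h, F (g * h) = F g ∘ F h) : G →* Equiv.Perm X :=
  letI : MulAction G X :=
    { smul := F
      one_smul := fun x => congrFun h₁ x
      mul_smul := fun g h x => congrFun (hmul g h) x }
  MulAction.toPermHom G X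

/-- A decomposition of an algebra as the free product of free algebras, indexed by the points of
finite sets; the free factors belonging to one finite set all have the same rank. -/
structure Columns (S : CantorSystem) (U : Type) [OmegaAlgebra S U] {J : Type} (m ρ : J → ℕ) where
  sat : Satisfies S U
  ι : ∀ i, Fin (m i) → CAlg S (ρ i) → U
  isHom : ∀ i p, IsHom S (ι i p)
  exists_desc : ∀ (N : Type) [OmegaAlgebra S N], Satisfies S N →
    ∀ h : ∀ i, Fin (m i) → CAlg S (ρ i) → N, (∀ i p, IsHom S (h i p)) →
    ∃ H : U → N, IsHom S H ∧ ∀ i p u, H (ι i p u) = h i p u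
  hom_ext : ∀ (N : Type) [OmegaAlgebra S N], Satisfies S N → ∀ h k : U → N, IsHom S h →
    IsHom S k → (∀ i p x, h (ι i p (gen S _ x)) = k (ι i p (gen S _ x))) → h = k

namespace Columns

variable {S : CantorSystem} {U : Type} [OmegaAlgebra S U] {J : Type} {m ρ : J → ℕ}
  (C : Columns S U m ρ)

section Basic

variable {N : Type} [OmegaAlgebra S N]

theorem hom_ext_basis (hN : Satisfies S N) {h k : U → N} (hh : IsHom S h) (hk : IsHom S k)
    {B : ∀ i, Fin (m i) → Set (CAlg S (ρ i))} (hB : ∀ i p, IsBasis S (B i p))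
    (hhk : ∀ i p, ∀ b ∈ B i p, h (C.ι i p b) = k (C.ι i p b)) : h = k :=
  C.hom_ext N hN h k hh hk fun i p _ => congrFun
    ((hB i p).hom_ext hN (hh.comp (C.isHom i p)) (hk.comp (C.isHom i p)) (hhk i p)) _

theorem isBasis_iUnion {B : ∀ i, Fin (m i) → Set (CAlg S (ρ i))}
    (hB : ∀ i p, IsBasis S (B i p)) : IsBasis S (⋃ i, ⋃ p, C.ι i p '' B i p) := by
  have hmem : ∀ i p, ∀ b ∈ B i p, C.ι i p b ∈ ⋃ i, ⋃ p, C.ι i p '' B i p := fun i p b hb =>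
    Set.mem_iUnion₂.2 ⟨i, p, Set.mem_image_of_mem _ hb⟩
  refine .mk_of_exists_ext (fun N _ hN θ => ?_) fun N _ hN h k hh hk hhk => ?_
  · have hex := fun i p => (hB i p N hN fun b => θ ⟨_, hmem i p b b.2⟩).exists
    choose h hh hθ using hex
    obtain ⟨H, hH, hH'⟩ := C.exists_desc N hN h hh
    refine ⟨H, hH, ?_⟩
    rintro ⟨x, hx⟩
    obtain ⟨i, p, b, hb, rfl⟩ := Set.mem_iUnion₂.1 hx
    exact (hH' i p b).trans (hθ i p ⟨b, hb⟩)
  · exact C.hom_ext_basis hN hh hk hB fun i p b hb => hhk _ (hmem i p b hb)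

theorem exists_split (hS : HasModel S) {T : Set U}
    (h : Refine S (⋃ i, ⋃ p, C.ι i p '' gens S (ρ i)) T) :
    ∃ A : ∀ i, Fin (m i) → Set (CAlg S (ρ i)), (∀ i p, IsBasis S (A i p)) ∧
      T = ⋃ i, ⋃ p, C.ι i p '' A i p := by
  obtain ⟨τ, rfl⟩ := h
  refine ⟨fun i p => ⋃ a ∈ gens S (ρ i), (τ (C.ι i p a)).leaves a,
    fun i p => isBasis_gens.of_refine hS ⟨_, rfl⟩, ?_⟩
  simp only [Set.biUnion_iUnion, Set.biUnion_image, Set.image_iUnion₂,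
    Tree.image_leaves (C.isHom _ _)]

open Classical in
/-- A homomorphism can be prescribed on one factor. -/
theorem exists_desc_factor (hN : Satisfies S N) (i : J) (p : Fin (m i)) {h : CAlg S (ρ i) → N}
    (hh : IsHom S h) (y : N) :
    ∃ H : U → N, IsHom S H ∧ (∀ u, H (C.ι i p u) = h u) ∧
      ∀ j q, (⟨j, q⟩ : Σ i, Fin (m i)) ≠ ⟨i, p⟩ → ∀ u,
        H (C.ι j q u) = CAlg.lift hN (fun _ => y) u := by
  obtain ⟨H, hH, hH'⟩ := C.exists_desc N hN
    (Function.update (fun j _ => CAlg.lift hN fun _ => y) i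
      (Function.update (fun _ => CAlg.lift hN fun _ => y) p h)) (by
    intro j q
    rcases eq_or_ne j i with rfl | hj
    · rw [Function.update_self]
      rcases eq_or_ne q p with rfl | hq
      · rwa [Function.update_self]
      · rw [Function.update_of_ne hq]
        exact CAlg.isHom_lift _ _
    · rw [Function.update_of_ne hj]
      exact CAlg.isHom_lift _ _)
  refine ⟨H, hH, fun u => by simp [hH'], fun j q hjq u => ?_⟩
  rw [hH']
  rcases eq_or_ne j i with rfl | hj
  · rw [Function.update_self, Function.update_of_ne]
    rintro rfl
    exact hjq rfl
  · rw [Function.update_of_ne hj]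

theorem injective (i : J) (p : Fin (m i)) : Function.Injective (C.ι i p) := by
  intro u u' huu
  obtain ⟨H, -, hH, -⟩ := C.exists_desc_factor (satisfies_CAlg S (ρ i)) i p IsHom.id u
  rw [← id_eq u, ← id_eq u', ← hH, huu, hH]

/-- Homomorphisms separated at `a` on the copy `(i, p)` extend to `U` with equal values on all other
copies. Taking `a` in a basis is what makes the separation possible. -/
theorem eq_of_ι_eq (hS : HasModel S) {i j : J} {p : Fin (m i)} {q : Fin (m j)}
    {A : Set (CAlg S (ρ i))} (hA : IsBasis S A) {a : CAlg S (ρ i)} (ha : a ∈ A)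
    {u : CAlg S (ρ j)} (h : C.ι i p a = C.ι j q u) : (⟨i, p⟩ : Σ i, Fin (m i)) = ⟨j, q⟩ := by
  by_contra hne
  obtain ⟨N, _, h₁, h₂, hN, hh₁, hh₂, -, hsep⟩ :=
    hA.exists_separating hS (τ := .leaf) (a := a) (b := a) rfl
  obtain ⟨H₁, -, e₁, e₁'⟩ := C.exists_desc_factor hN i p hh₁ (h₁ a)
  obtain ⟨H₂, -, e₂, e₂'⟩ := C.exists_desc_factor hN i p hh₂ (h₁ a)
  refine hsep ha ?_
  rw [← e₁, ← e₂, h, e₁' j q (Ne.symm hne), e₂' j q (Ne.symm hne)]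

open Classical in
theorem exists_block (i : J) {h : Fin (m i) → CAlg S (ρ i) → U} (hh : ∀ p, IsHom S (h p)) :
    ∃ H : U → U, IsHom S H ∧ (∀ p u, H (C.ι i p u) = h p u) ∧
      ∀ j, j ≠ i → ∀ p u, H (C.ι j p u) = C.ι j p u := by
  obtain ⟨H, hH, hH'⟩ := C.exists_desc U C.sat (Function.update C.ι i h) (by
    intro j q
    rcases eq_or_ne j i with rfl | hj
    · rw [Function.update_self]
      exact hh q
    · rw [Function.update_of_ne hj]
      exact C.isHom j q)
  exact ⟨H, hH, fun p u => by simp [hH'], fun j hj p u => by rw [hH', Function.update_of_ne hj]⟩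

theorem block_ext {i : J} {h k : U → U} (hh : IsHom S h) (hk : IsHom S k)
    {A : Set (CAlg S (ρ i))} (hA : IsBasis S A)
    (h₁ : ∀ p, ∀ a ∈ A, h (C.ι i p a) = k (C.ι i p a))
    (h₂ : ∀ j, j ≠ i → ∀ p u, h (C.ι j p u) = k (C.ι j p u)) : h = k := by
  refine C.hom_ext U C.sat h k hh hk fun j p x => ?_
  by_cases hj : j = i
  · subst hj
    exact congrFun (hA.hom_ext C.sat (hh.comp (C.isHom j p)) (hk.comp (C.isHom j p)) (h₁ p)) _
  · exact h₂ j hj p _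

end Basic

section Kernel

variable (L : ∀ i, Subgroup (Equiv.Perm (Fin (m i)))) (i : J)

theorem exists_kappa (A : Bases S (ρ i)) (f : A.1 → L i) :
    ∃ H : U → U, IsHom S H ∧
      (∀ p (a : A.1), H (C.ι i p a) = C.ι i ((f a : Equiv.Perm (Fin (m i))) p) a) ∧
      ∀ j, j ≠ i → ∀ p u, H (C.ι j p u) = C.ι j p u := by
  choose h hh hf using fun p => (A.2 U C.sat fun a =>
    C.ι i ((f a : Equiv.Perm (Fin (m i))) p) a).exists
  obtain ⟨H, hH, h₁, h₂⟩ := C.exists_block i hh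
  exact ⟨H, hH, fun p a => by rw [h₁, hf], h₂⟩

/-- The endomorphism that permutes the copies of `a` by `f a` for all elements `a` of a basis. -/
noncomputable def kappa (A : Bases S (ρ i)) (f : A.1 → L i) : U → U :=
  (C.exists_kappa L i A f).choose

theorem isHom_kappa (A : Bases S (ρ i)) (f : A.1 → L i) : IsHom S (C.kappa L i A f) :=
  (C.exists_kappa L i A f).choose_spec.1

theorem kappa_ι (A : Bases S (ρ i)) (f : A.1 → L i) (p : Fin (m i)) (a : A.1) :
    C.kappa L i A f (C.ι i p a) = C.ι i ((f a : Equiv.Perm (Fin (m i))) p) a :=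
  (C.exists_kappa L i A f).choose_spec.2.1 p a

theorem kappa_ι_of_ne (A : Bases S (ρ i)) (f : A.1 → L i) {j : J} (hj : j ≠ i) (p : Fin (m j))
    (u : CAlg S (ρ j)) : C.kappa L i A f (C.ι j p u) = C.ι j p u :=
  (C.exists_kappa L i A f).choose_spec.2.2 j hj p u

/-- The representation of `Maps(A, L)` by automorphisms. -/
noncomputable def kappaHom (A : Bases S (ρ i)) : (A.1 → L i) →* Equiv.Perm U :=
  permHom (C.kappa L i A)
    (C.block_ext (C.isHom_kappa L i A 1) IsHom.id A.2
      (fun p a ha => C.kappa_ι L i A 1 p ⟨a, ha⟩)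
      fun _ hj p u => C.kappa_ι_of_ne L i A 1 hj p u)
    fun f g => C.block_ext (C.isHom_kappa L i A _)
      ((C.isHom_kappa L i A f).comp (C.isHom_kappa L i A g)) A.2
      (fun p a ha => by
        rw [C.kappa_ι L i A _ p ⟨a, ha⟩, Function.comp_apply, C.kappa_ι L i A g p ⟨a, ha⟩,
          C.kappa_ι L i A f _ ⟨a, ha⟩]
        rfl)
      fun _ hj p u => by
        rw [Function.comp_apply, C.kappa_ι_of_ne L i A _ hj, C.kappa_ι_of_ne L i A _ hj,
          C.kappa_ι_of_ne L i A _ hj]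

/-- Permuting the copies of `a` by `f a` permutes the copies of each child in the same way, which is
the diagonal map; hence the action descends to the colimit. -/
theorem kappa_diag (A : Bases S (ρ i)) {a : CAlg S (ρ i)} (ha : a ∈ A.1) (c : Fin S.s)
    (hB : IsBasis S (expand S A.1 a c)) (f : A.1 → L i) :
    C.kappa L i ⟨_, hB⟩ (diag ha c f) = C.kappa L i A f := by
  refine C.block_ext (C.isHom_kappa L i _ _) (C.isHom_kappa L i _ _) hB (fun p b hb => ?_)
    fun _ hj p u => by rw [C.kappa_ι_of_ne L i _ _ hj, C.kappa_ι_of_ne L i _ _ hj]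
  rw [C.kappa_ι L i ⟨_, hB⟩ _ p ⟨b, hb⟩]
  by_cases hr : b ∈ Set.range fun j => OmegaAlgebra.alpha (S := S) c j a
  · simp only [diag, dif_pos hr]
    obtain ⟨j, rfl⟩ := hr
    rw [(C.isHom i _).2, (C.isHom i _).2, (C.isHom_kappa L i A f).2, C.kappa_ι L i A f p ⟨a, ha⟩]
  · simp only [diag, dif_neg hr]
    exact (C.kappa_ι L i A f p ⟨b, _⟩).symm

/-- The representation of the colimit by automorphisms. -/
noncomputable def colimHom : Colim S (ρ i) (L i) →* Equiv.Perm U :=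
  Colim.desc (C.kappaHom L i) fun A _ ha c hB f =>
    Equiv.ext fun x => congrFun (C.kappa_diag L i A ha c hB f) x

theorem colimHom_mk (A : Bases S (ρ i)) (f : A.1 → L i) :
    ⇑(C.colimHom L i (Colim.mk A f)) = C.kappa L i A f := by
  rw [colimHom, Colim.desc_mk]
  rfl

theorem exists_sigma (v : V S (ρ i)) :
    ∃ H : U → U, IsHom S H ∧ (∀ p u, H (C.ι i p u) = C.ι i p (v.1 u)) ∧
      ∀ j, j ≠ i → ∀ p u, H (C.ι j p u) = C.ι j p u :=
  C.exists_block i fun p => (C.isHom i p).comp (V_le_autGroup S _ v.2)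

/-- The endomorphism that acts as `v` on all copies. -/
noncomputable def sigma (v : V S (ρ i)) : U → U := (C.exists_sigma i v).choose

theorem isHom_sigma (v : V S (ρ i)) : IsHom S (C.sigma i v) :=
  (C.exists_sigma i v).choose_spec.1

theorem sigma_ι (v : V S (ρ i)) (p : Fin (m i)) (u : CAlg S (ρ i)) :
    C.sigma i v (C.ι i p u) = C.ι i p (v.1 u) :=
  (C.exists_sigma i v).choose_spec.2.1 p u

theorem sigma_ι_of_ne (v : V S (ρ i)) {j : J} (hj : j ≠ i) (p : Fin (m j))
    (u : CAlg S (ρ j)) : C.sigma i v (C.ι j p u) = C.ι j p u :=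
  (C.exists_sigma i v).choose_spec.2.2 j hj p u

/-- The representation of `V` by automorphisms acting in the same way on all copies. -/
noncomputable def sigmaHom : V S (ρ i) →* Equiv.Perm U :=
  permHom (C.sigma i)
    (C.block_ext (C.isHom_sigma i 1) IsHom.id isBasis_gens
      (fun p a _ => C.sigma_ι i 1 p a) fun _ hj p u => C.sigma_ι_of_ne i 1 hj p u)
    fun v w => C.block_ext (C.isHom_sigma i _) ((C.isHom_sigma i v).comp (C.isHom_sigma i w))
      isBasis_gens
      (fun p a _ => by
        rw [Function.comp_apply, C.sigma_ι, C.sigma_ι, C.sigma_ι]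
        rfl)
      fun _ hj p u => by
        rw [Function.comp_apply, C.sigma_ι_of_ne i _ hj, C.sigma_ι_of_ne i _ hj,
          C.sigma_ι_of_ne i _ hj]

/-- Conjugation by the simultaneous action of `v` moves `A` to `vA`: the relation that makes the two
actions fit into a semidirect product. -/
theorem sigma_kappa (v : V S (ρ i)) (A : Bases S (ρ i)) (f : A.1 → L i) :
    C.kappa L i (moveBasis v A) (moveMap v A f) ∘ C.sigma i v =
      C.sigma i v ∘ C.kappa L i A f := by
  refine C.block_ext ((C.isHom_kappa L i _ _).comp (C.isHom_sigma i v))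
    ((C.isHom_sigma i v).comp (C.isHom_kappa L i A f)) A.2 (fun p a ha => ?_) fun _ hj p u => ?_
  · have hva : v.1 a ∈ (moveBasis v A).1 := Set.mem_image_of_mem _ ha
    rw [Function.comp_apply, Function.comp_apply, C.sigma_ι, C.kappa_ι L i A f p ⟨a, ha⟩,
      C.sigma_ι, C.kappa_ι L i (moveBasis v A) _ p ⟨_, hva⟩]
    simp [moveMap]
  · rw [Function.comp_apply, Function.comp_apply, C.sigma_ι_of_ne i v hj,
      C.kappa_ι_of_ne L i _ _ hj, C.kappa_ι_of_ne L i _ _ hj, C.sigma_ι_of_ne i v hj]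

/-- The representation of one factor of the centraliser. -/
noncomputable def blockHom : GFactor S (ρ i) (L i) →* Equiv.Perm U :=
  SemidirectProduct.lift (C.colimHom L i) (C.sigmaHom i) fun v => by
    refine Colim.hom_ext fun A f => ?_
    refine eq_mul_inv_of_mul_eq (Equiv.ext fun x => ?_)
    have h₁ : Colim.action S (ρ i) (L i) v (Colim.mk A f) = _ := Colim.move_mk v A f
    have h₂ := congrFun (C.sigma_kappa L i v A f) x
    simp only [MonoidHom.comp_apply, MulEquiv.coe_toMonoidHom, h₁, Equiv.Perm.mul_apply,
      C.colimHom_mk]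
    exact h₂

theorem blockHom_apply (A : Bases S (ρ i)) (f : A.1 → L i) (v : V S (ρ i)) :
    ⇑(C.blockHom L i ⟨Colim.mk A f, v⟩) = C.kappa L i A f ∘ C.sigma i v := by
  rw [← C.colimHom_mk]
  rfl

end Kernel

end Columns

theorem IsBasis.exists_aut {S : CantorSystem} {U : Type} [OmegaAlgebra S U] (hU : Satisfies S U)
    {A B : Set U} (hA : IsBasis S A) (hB : IsBasis S B) (e : A ≃ B) :
    ∃ v ∈ autGroup S U, ∀ a : A, v a = e a := by
  obtain ⟨h, ⟨hh, hA'⟩, -⟩ := hA U hU fun a => e a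
  obtain ⟨k, ⟨hk, hB'⟩, -⟩ := hB U hU fun b => e.symm b
  have hkh : k ∘ h = id := hA.hom_ext hU (hk.comp hh) IsHom.id fun a ha => by
    rw [Function.comp_apply, hA' ⟨a, ha⟩, hB', e.symm_apply_apply]
    rfl
  have hhk : h ∘ k = id := hB.hom_ext hU (hh.comp hk) IsHom.id fun b hb => by
    rw [Function.comp_apply, hB' ⟨b, hb⟩, hA', e.apply_symm_apply]
    rfl
  exact ⟨⟨h, k, congrFun hkh, congrFun hhk⟩, hh, hA'⟩

/-- Both sets are the coset space of the common stabiliser; the equivalence sends `ψ q p` to `ψ' q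
p'`. -/
theorem equivRep_of_stabilizer_eq {Q : Type} [Group Q] {m m' : ℕ} {ψ : Q →* Equiv.Perm (Fin m)}
    {ψ' : Q →* Equiv.Perm (Fin m')} (hψ : IsTransRep ψ) (hψ' : IsTransRep ψ') {p : Fin m}
    {p' : Fin m'} (h : ∀ q, ψ q p = p ↔ ψ' q p' = p') : EquivRep ψ ψ' := by
  have key : ∀ q q', ψ q p = ψ q' p ↔ ψ' q p' = ψ' q' p' := fun q q' => by
    have := h (q'⁻¹ * q)
    rwa [map_mul, map_mul, map_inv, map_inv, Equiv.Perm.mul_apply, Equiv.Perm.mul_apply,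
      Equiv.Perm.inv_eq_iff_eq, Equiv.Perm.inv_eq_iff_eq] at this
  choose s hs using hψ.2 p
  have hinj : Function.Injective fun k => ψ' (s k) p' := fun k k' hk => by
    rw [← hs k, ← hs k']
    exact (key _ _).2 hk
  have hsurj : Function.Surjective fun k => ψ' (s k) p' := fun k' => by
    obtain ⟨q, rfl⟩ := hψ'.2 p' k'
    exact ⟨ψ q p, (key _ _).1 (hs _)⟩
  refine ⟨Equiv.ofBijective _ ⟨hinj, hsurj⟩, fun q k => ?_⟩
  have : ψ' (s (ψ q k)) p' = ψ' (q * s k) p' := by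
    rw [← key, hs, map_mul, Equiv.Perm.mul_apply, hs]
  rw [map_mul, Equiv.Perm.mul_apply] at this
  exact this

namespace Columns

variable {S : CantorSystem} {U : Type} [OmegaAlgebra S U] {J : Type} {m ρ : J → ℕ}
  (C : Columns S U m ρ)

/-! ### The product of the factors acting on the whole algebra -/

section Total

variable (L : ∀ i, Subgroup (Equiv.Perm (Fin (m i))))

theorem blockHom_ι (i : J) (A : Bases S (ρ i)) (f : A.1 → L i) (v : V S (ρ i)) (p : Fin (m i))
    {u : CAlg S (ρ i)} (hu : v.1 u ∈ A.1) :
    C.blockHom L i ⟨Colim.mk A f, v⟩ (C.ι i p u) =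
      C.ι i ((f ⟨v.1 u, hu⟩ : Equiv.Perm (Fin (m i))) p) (v.1 u) := by
  rw [C.blockHom_apply, Function.comp_apply, C.sigma_ι, C.kappa_ι L i A f p ⟨_, hu⟩]

theorem exists_eq_mk (hS : HasModel S) (hc : Confluent S) {i : J} (x : GFactor S (ρ i) (L i)) :
    ∃ (A : Bases S (ρ i)) (f : A.1 → L i) (v : V S (ρ i)), x = ⟨Colim.mk A f, v⟩ := by
  obtain ⟨n, v⟩ := x
  obtain ⟨A, f, rfl⟩ := Colim.exists_mk hS hc n
  exact ⟨A, f, v, rfl⟩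

theorem isHom_blockHom (hS : HasModel S) (hc : Confluent S) (i : J)
    (x : GFactor S (ρ i) (L i)) : IsHom S (C.blockHom L i x) := by
  obtain ⟨A, f, v, rfl⟩ := exists_eq_mk L hS hc x
  rw [C.blockHom_apply]
  exact (C.isHom_kappa L i A f).comp (C.isHom_sigma i v)

/-- Permuting different basis elements differently need not carry a copy into a copy; this holds
only on a suitable basis, which suffices to check multiplicativity in `total_mul`. -/
theorem exists_basis_blockHom (hS : HasModel S) (hc : Confluent S) (i : J)
    (x : GFactor S (ρ i) (L i)) : ∃ B : Set (CAlg S (ρ i)), IsBasis S B ∧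
      ∀ p, ∀ b ∈ B, ∃ p' b', C.blockHom L i x (C.ι i p b) = C.ι i p' b' := by
  obtain ⟨A, f, v, rfl⟩ := exists_eq_mk L hS hc x
  refine ⟨_, (moveBasis v⁻¹ A).2, ?_⟩
  rintro p _ ⟨a, ha, rfl⟩
  exact ⟨_, _, C.blockHom_ι L i A f v p (by simpa using ha)⟩

theorem exists_total (hS : HasModel S) (hc : Confluent S) (x : ∀ i, GFactor S (ρ i) (L i)) :
    ∃ H : U → U, IsHom S H ∧ ∀ i p u, H (C.ι i p u) = C.blockHom L i (x i) (C.ι i p u) :=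
  C.exists_desc U C.sat _ fun i p => (C.isHom_blockHom L hS hc i (x i)).comp (C.isHom i p)

/-- The endomorphism that acts on every family of copies by the given element. -/
noncomputable def total (hS : HasModel S) (hc : Confluent S) (x : ∀ i, GFactor S (ρ i) (L i)) :
    U → U := (C.exists_total L hS hc x).choose

variable (hS : HasModel S) (hc : Confluent S)

theorem isHom_total (x : ∀ i, GFactor S (ρ i) (L i)) : IsHom S (C.total L hS hc x) :=
  (C.exists_total L hS hc x).choose_spec.1

theorem total_ι (x : ∀ i, GFactor S (ρ i) (L i)) (i : J) (p : Fin (m i)) (u : CAlg S (ρ i)) :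
    C.total L hS hc x (C.ι i p u) = C.blockHom L i (x i) (C.ι i p u) :=
  (C.exists_total L hS hc x).choose_spec.2 i p u

theorem total_one : C.total L hS hc 1 = id :=
  C.hom_ext U C.sat _ _ (C.isHom_total L hS hc 1) IsHom.id fun i p x => by
    rw [C.total_ι, Pi.one_apply, map_one]
    rfl

theorem total_mul (x y : ∀ i, GFactor S (ρ i) (L i)) :
    C.total L hS hc (x * y) = C.total L hS hc x ∘ C.total L hS hc y := by
  choose B hB H using fun i => C.exists_basis_blockHom L hS hc i (y i)
  refine C.hom_ext_basis C.sat (C.isHom_total L hS hc _)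
    ((C.isHom_total L hS hc x).comp (C.isHom_total L hS hc y)) (fun i _ => hB i) fun i p b hb => ?_
  obtain ⟨p', b', h⟩ := H i p b hb
  rw [Function.comp_apply, C.total_ι, C.total_ι, h, C.total_ι, Pi.mul_apply, map_mul,
    Equiv.Perm.mul_apply, h]

/-- The product of the factors acts by automorphisms. -/
noncomputable def totalHom : (∀ i, GFactor S (ρ i) (L i)) →* Equiv.Perm U :=
  permHom (C.total L hS hc) (C.total_one L hS hc) (C.total_mul L hS hc)

theorem totalHom_ι (x : ∀ i, GFactor S (ρ i) (L i)) (i : J) (p : Fin (m i)) (u : CAlg S (ρ i)) :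
    C.totalHom L hS hc x (C.ι i p u) = C.blockHom L i (x i) (C.ι i p u) :=
  C.total_ι L hS hc x i p u

theorem totalHom_mem_autGroup (x : ∀ i, GFactor S (ρ i) (L i)) :
    C.totalHom L hS hc x ∈ autGroup S U := C.isHom_total L hS hc x

theorem totalHom_injective (hm : ∀ i, 0 < m i) : Function.Injective (C.totalHom L hS hc) := by
  rw [injective_iff_map_eq_one]
  intro x hx
  funext i
  obtain ⟨A, f, v, hxi⟩ := exists_eq_mk L hS hc (x i)
  -- Evaluating at the copies of `v⁻¹a` puts `f` and `v` into one equation: disjointness of copies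
  -- gives `f = 1`, then injectivity of a copy gives `v = 1`.
  have key : ∀ p, ∀ a (ha : a ∈ A.1),
      C.ι i ((f ⟨a, ha⟩ : Equiv.Perm (Fin (m i))) p) a = C.ι i p (v.1⁻¹ a) := by
    intro p a ha
    have hva : v.1 (v.1⁻¹ a) = a := by simp
    have h := C.totalHom_ι L hS hc x i p (v.1⁻¹ a)
    rw [hx, hxi, C.blockHom_ι L i A f v p (hva.symm ▸ ha)] at h
    simp only [hva] at h
    exact h.symm
  have hp : ∀ p, ∀ a (ha : a ∈ A.1), (f ⟨a, ha⟩ : Equiv.Perm (Fin (m i))) p = p := by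
    intro p a ha
    simpa using C.eq_of_ι_eq hS A.2 ha (key p a ha)
  have hv : v = 1 := by
    have hinv := (autGroup S _).inv_mem (V_le_autGroup S _ v.2)
    have hid : ⇑(v.1⁻¹) = id :=
      A.2.hom_ext (satisfies_CAlg S (ρ i)) hinv IsHom.id fun a ha => by
        have h := key ⟨0, hm i⟩ a ha
        rw [hp] at h
        exact (C.injective _ _ h).symm
    exact Subtype.ext (inv_eq_one.1 (Equiv.ext (congrFun hid)))
  have hf : f = 1 := by
    funext ⟨a, ha⟩
    exact Subtype.ext (Equiv.ext fun p => hp p a ha)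
  rw [hxi, hv, hf, Colim.mk_one]
  rfl

end Total

/-! ### Elements commuting with Q -/

section Equivariant

variable {Q : Type} [Group Q] [MulAction Q U] {φ : ∀ i, Q →* Equiv.Perm (Fin (m i))}

theorem mem_of_ι_mem (hS : HasModel S) {A : ∀ i, Fin (m i) → Set (CAlg S (ρ i))}
    {i : J} {p : Fin (m i)} {a : CAlg S (ρ i)} {B : Set (CAlg S (ρ i))} (hB : IsBasis S B)
    (ha : a ∈ B) (h : C.ι i p a ∈ ⋃ i, ⋃ p, C.ι i p '' A i p) : a ∈ A i p := by
  obtain ⟨j, p', a', ha', h⟩ := Set.mem_iUnion₂.1 h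
  cases C.eq_of_ι_eq hS hB ha h.symm
  rwa [← C.injective _ _ h]

/-- A refinement splits copy by copy; as Q permutes the copies of one block transitively, invariance
forces the same basis in each of them. -/
theorem exists_split_invariant (hS : HasModel S) (hφ : ∀ i, IsTransRep (φ i))
    (hq : ∀ (q : Q) i p u, q • C.ι i p u = C.ι i (φ i q p) u) {T : Set U}
    (h : Refine S (⋃ i, ⋃ p, C.ι i p '' gens S (ρ i)) T) (hT : ∀ (q : Q), ∀ t ∈ T, q • t ∈ T) :
    ∃ A : ∀ i, Set (CAlg S (ρ i)), (∀ i, IsBasis S (A i)) ∧ T = ⋃ i, ⋃ p, C.ι i p '' A i := by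
  obtain ⟨A, hA, rfl⟩ := C.exists_split hS h
  have hsub : ∀ i p p', A i p ⊆ A i p' := fun i p p' a ha => by
    obtain ⟨q, rfl⟩ := (hφ i).2 p p'
    refine C.mem_of_ι_mem hS (hA i p) ha ?_
    rw [← hq]
    exact hT q _ (Set.mem_iUnion₂.2 ⟨i, p, Set.mem_image_of_mem _ ha⟩)
  refine ⟨fun i => A i ⟨0, (hφ i).1⟩, fun i => hA i _, ?_⟩
  refine Set.iUnion₂_congr fun i p => ?_
  rw [(hsub i p _).antisymm (hsub i _ p)]

theorem exists_blockHom_eq (hS : HasModel S) (hc : Confluent S) (hφ : ∀ i, IsTransRep (φ i))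
    (hsep : ∀ i j p p', (∀ q, φ i q p = p ↔ φ j q p' = p') → i = j)
    (hq : ∀ (q : Q) i p u, q • C.ι i p u = C.ι i (φ i q p) u) {g : Equiv.Perm U}
    (hgq : ∀ (q : Q) u, g (q • u) = q • g u)
    {A A' : ∀ i, Set (CAlg S (ρ i))} (hA : ∀ i, IsBasis S (A i)) (hA' : ∀ i, IsBasis S (A' i))
    (hgA : g '' (⋃ i, ⋃ p, C.ι i p '' A' i) = ⋃ i, ⋃ p, C.ι i p '' A i) (i : J) :
    ∃ x : GFactor S (ρ i) (centRep (φ i)), ∀ p, ∀ a ∈ A' i,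
      C.blockHom (fun i => centRep (φ i)) i x (C.ι i p a) = g (C.ι i p a) := by
  have hinj : ∀ {i : J} {p p' : Fin (m i)} {a b : CAlg S (ρ i)} {B : Set (CAlg S (ρ i))},
      IsBasis S B → a ∈ B → C.ι i p a = C.ι i p' b → p = p' ∧ a = b := by
    intro i p p' a b B hB ha h
    obtain rfl : p = p' := by simpa using C.eq_of_ι_eq hS hB ha h
    exact ⟨rfl, C.injective _ _ h⟩
  have hmap : ∀ i p, ∀ a ∈ A' i, ∃ p', ∃ b ∈ A i, g (C.ι i p a) = C.ι i p' b := by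
    intro i p a ha
    have hmem : g (C.ι i p a) ∈ ⋃ i, ⋃ p, C.ι i p '' A i := by
      rw [← hgA]
      exact Set.mem_image_of_mem _ (Set.mem_iUnion₂.2 ⟨i, p, Set.mem_image_of_mem _ ha⟩)
    obtain ⟨j, p', b, hb, h⟩ := Set.mem_iUnion₂.1 hmem
    -- `g` preserves stabilisers in Q, and these determine the type of a transitive action.
    obtain rfl : i = j := by
      refine hsep i j p p' fun q => ?_
      constructor
      · intro hqp
        have : C.ι j (φ j q p') b = C.ι j p' b := by rw [← hq, h, ← hgq, hq, hqp]
        exact (hinj (hA j) hb this).1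
      · intro hqp
        have : C.ι i (φ i q p) a = C.ι i p a := by
          apply g.injective
          rw [← hq, hgq, ← h, hq, hqp]
        exact (hinj (hA' i) ha this).1
    exact ⟨p', b, hb, h.symm⟩
  have hcol : ∀ i, ∀ a : A' i, ∃ (b : A i) (F : centRep (φ i)), ∀ p,
      g (C.ι i p a) = C.ι i ((F : Equiv.Perm (Fin (m i))) p) b := by
    rintro i ⟨a, ha⟩
    obtain ⟨p', b, hb, h⟩ := hmap i ⟨0, (hφ i).1⟩ a ha
    have hall : ∀ p, ∃ p'', g (C.ι i p a) = C.ι i p'' b := fun p => by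
      obtain ⟨q, rfl⟩ := (hφ i).2 ⟨0, (hφ i).1⟩ p
      exact ⟨φ i q p', by rw [← hq, hgq, h, hq]⟩
    choose F hF using hall
    have hFinj : Function.Injective F := fun p₁ p₂ hp => by
      have := g.injective ((hF p₁).trans (hp ▸ (hF p₂).symm))
      exact (hinj (hA' i) ha this).1
    refine ⟨⟨b, hb⟩, ⟨Equiv.ofBijective F (Finite.injective_iff_bijective.1 hFinj), ?_⟩, hF⟩
    rw [Subgroup.mem_centralizer_iff]
    rintro _ ⟨q, rfl⟩
    ext1 p
    have : C.ι i (φ i q (F p)) b = C.ι i (F (φ i q p)) b := by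
      rw [← hq, ← hF, ← hF, ← hgq, hq]
    exact (hinj (hA i) hb this).1
  choose β F hF using hcol
  have hβ : Function.Bijective (β i) := by
    constructor
    · intro a a' haa
      have h₁ := hF i a (((F i a : Equiv.Perm (Fin (m i))))⁻¹ ⟨0, (hφ i).1⟩)
      have h₂ := hF i a' (((F i a' : Equiv.Perm (Fin (m i))))⁻¹ ⟨0, (hφ i).1⟩)
      rw [Equiv.Perm.inv_def, Equiv.apply_symm_apply] at h₁ h₂
      rw [haa] at h₁
      exact Subtype.ext (hinj (hA' i) a.2 (g.injective (h₁.trans h₂.symm))).2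
    · rintro ⟨b, hb⟩
      have hmem : C.ι i ⟨0, (hφ i).1⟩ b ∈ g '' ⋃ i, ⋃ p, C.ι i p '' A' i := by
        rw [hgA]
        exact Set.mem_iUnion₂.2 ⟨i, _, Set.mem_image_of_mem _ hb⟩
      obtain ⟨t, ht, hgt⟩ := hmem
      obtain ⟨j, p, a, ha, rfl⟩ := Set.mem_iUnion₂.1 ht
      rw [hF j ⟨a, ha⟩] at hgt
      have hij := C.eq_of_ι_eq hS (hA i) hb hgt.symm
      obtain rfl : i = j := congrArg Sigma.fst hij
      exact ⟨⟨a, ha⟩, Subtype.ext (hinj (hA i) hb hgt.symm).2.symm⟩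
  obtain ⟨v, hv, hvβ⟩ := (hA' i).exists_aut (satisfies_CAlg S _) (hA i) (Equiv.ofBijective _ hβ)
  set e := Equiv.ofBijective _ hβ
  -- `v` moves `a` to `β a` before the copies are permuted, so the permutations have to be indexed
  -- by the target basis.
  refine ⟨⟨Colim.mk ⟨A i, hA i⟩ fun b => F i (e.symm b), ⟨v, ?_⟩⟩, fun p a ha => ?_⟩
  · rw [V_eq_autGroup hS hc]
    exact hv
  · have hva : v a = β i ⟨a, ha⟩ := hvβ ⟨a, ha⟩
    have hmem : v a ∈ A i := hva ▸ (β i ⟨a, ha⟩).2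
    rw [hF i ⟨a, ha⟩ p, C.blockHom_ι _ i ⟨A i, hA i⟩ _ ⟨v, _⟩ p hmem]
    have : e.symm ⟨v a, hmem⟩ = ⟨a, ha⟩ := by
      rw [Equiv.symm_apply_eq]
      exact Subtype.ext hva
    rw [this]
    exact congrArg (C.ι i _) hva

theorem smul_totalHom (hS : HasModel S) (hc : Confluent S)
    (hq : ∀ (q : Q) i p u, q • C.ι i p u = C.ι i (φ i q p) u)
    (hqhom : ∀ q : Q, IsHom S fun u : U => q • u)
    (x : ∀ i, GFactor S (ρ i) (centRep (φ i))) (q : Q) (u : U) :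
    C.totalHom (fun i => centRep (φ i)) hS hc x (q • u) =
      q • C.totalHom (fun i => centRep (φ i)) hS hc x u := by
  choose A f v hx using fun i => exists_eq_mk (fun i => centRep (φ i)) hS hc (x i)
  have hH := C.totalHom_mem_autGroup (fun i => centRep (φ i)) hS hc x
  refine congrFun (C.hom_ext_basis C.sat (hH.comp (hqhom q)) ((hqhom q).comp hH)
    (fun i _ => (moveBasis (v i)⁻¹ (A i)).2) ?_) u
  rintro i p _ ⟨a, ha, rfl⟩
  have hmem : (v i).1 ((((v i)⁻¹ : V S (ρ i)) : Equiv.Perm (CAlg S (ρ i))) a) ∈ (A i).1 := by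
    simpa using ha
  rw [Function.comp_apply, Function.comp_apply, hq, C.totalHom_ι, C.totalHom_ι, hx,
    C.blockHom_ι _ i _ _ _ _ hmem, C.blockHom_ι _ i _ _ _ _ hmem, hq]
  congr 1
  have := Subgroup.mem_centralizer_iff.1 (f i ⟨_, hmem⟩).2 (φ i q) ⟨q, rfl⟩
  exact (congrArg (fun σ : Equiv.Perm (Fin (m i)) => σ p) this).symm

end Equivariant

end Columns

/-! ### Rank zero -/

section EmptyAlgebra

variable {S : CantorSystem}

instance isEmpty_CAlg : IsEmpty (CAlg S 0) := by
  refine ⟨fun u => ?_⟩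
  induction u using CAlg.induction with
  | hgen k => exact k.elim0
  | hlam i v ih => exact ih ⟨0, zero_lt_one.trans (S.one_lt i)⟩
  | halpha i j u ih => exact ih

instance subsingleton_colim {L : Type} [Group L] : Subsingleton (Colim S 0 L) := by
  have h : MonoidHom.id (Colim S 0 L) = 1 := Colim.hom_ext fun A f => by
    rw [Subsingleton.elim f 1, Colim.mk_one, map_one, map_one]
  exact subsingleton_of_forall_eq 1 fun x => DFunLike.congr_fun h x

theorem subsingleton_gFactor {L : Type} [Group L] {l : ℕ} (hl : l = 0) :
    Subsingleton (GFactor S l L) := by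
  subst hl
  exact ⟨fun x y => SemidirectProduct.ext (Subsingleton.elim _ _) (Subsingleton.elim _ _)⟩

end EmptyAlgebra

/-! ### Orbit types as coordinates on a fixed basis -/

section Orbits

variable {S : CantorSystem} {r t : ℕ} {m : Fin t → ℕ} {Q : Subgroup (V S r)}
  {φ : ∀ i : Fin t, Q →* Equiv.Perm (Fin (m i))}

theorem HasType.equivRep {m m' : ℕ} {ψ : Q →* Equiv.Perm (Fin m)} {ψ' : Q →* Equiv.Perm (Fin m')}
    {O : Set (CAlg S r)} (h : HasType Q ψ O) (h' : HasType Q ψ' O) : EquivRep ψ ψ' := by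
  obtain ⟨e, he⟩ := h
  obtain ⟨e', he'⟩ := h'
  refine ⟨e.trans e'.symm, fun q k => ?_⟩
  rw [Equiv.trans_apply, Equiv.symm_apply_eq]
  apply Subtype.ext
  rw [he, he']
  simp

theorem IsCompleteList.injective (hφ : IsCompleteList φ) {i j : Fin t}
    (h : EquivRep (φ i) (φ j)) : i = j :=
  (hφ.2 _ (φ j) (hφ.1 j)).unique h ⟨Equiv.refl _, fun _ _ => rfl⟩

theorem IsCompleteList.exists_hasType (hφ : IsCompleteList φ) (y : CAlg S r)
    (hfin : (MulAction.orbit Q y).Finite) : ∃ i, HasType Q (φ i) (MulAction.orbit Q y) := by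
  have : Finite (MulAction.orbit Q y) := hfin
  have : Nonempty (MulAction.orbit Q y) := (MulAction.nonempty_orbit y).to_subtype
  let e : Fin (Nat.card (MulAction.orbit Q y)) ≃ MulAction.orbit Q y :=
    (Finite.equivFin (MulAction.orbit Q y)).symm
  let ψ : Q →* Equiv.Perm (Fin (Nat.card (MulAction.orbit Q y))) :=
    (e.symm.permCongrHom.toMonoidHom).comp (MulAction.toPermHom Q (MulAction.orbit Q y))
  have hψ : ∀ q k, e (ψ q k) = q • e k := fun q k => e.apply_symm_apply _
  obtain ⟨i, ⟨e', he'⟩, -⟩ := hφ.2 _ ψ ⟨Nat.card_pos, fun k l => by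
    obtain ⟨q, hq⟩ := MulAction.exists_smul_eq Q (e k) (e l)
    exact ⟨q, e.injective ((hψ q k).trans hq)⟩⟩
  refine ⟨i, e'.trans e, fun q k => ?_⟩
  rw [Equiv.trans_apply, he', hψ]
  rfl

theorem IsFixedBasis.smul_mem {Y : Set (CAlg S r)} (hY : IsFixedBasis Q Y) (q : Q) {y : CAlg S r}
    (hy : y ∈ Y) : q • y ∈ Y := by
  rw [← hY.2 q]
  exact Set.mem_image_of_mem _ hy

/-- The points of a fixed basis are parametrised by the type of their orbit, the number of their
orbit among those of this type, and a point of the model of this type. -/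
theorem exists_coordinates (hS : HasModel S) (hφ : IsCompleteList φ) {Y : Set (CAlg S r)}
    (hY : IsFixedBasis Q Y) :
    ∃ y : ∀ i, Fin (orbitCount Q (φ i) Y) → Fin (m i) → CAlg S r,
      (∀ q i k p, q • y i k p = y i k (φ i q p)) ∧
      Set.BijOn (fun c : Σ i, Fin (orbitCount Q (φ i) Y) × Fin (m i) => y c.1 c.2.1 c.2.2)
        Set.univ Y := by
  have hfin := hY.1.finite hS
  have horb : ∀ y ∈ Y, MulAction.orbit Q y ⊆ Y := by
    rintro y hy _ ⟨q, rfl⟩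
    exact hY.smul_mem q hy
  let O : Fin t → Set (Set (CAlg S r)) := fun i =>
    {O | (∃ y ∈ Y, O = MulAction.orbit Q y) ∧ HasType Q (φ i) O}
  have hO : ∀ i, (O i).Finite := fun i => by
    refine (hfin.image fun y => MulAction.orbit Q y).subset ?_
    rintro _ ⟨⟨y, hy, rfl⟩, -⟩
    exact ⟨y, hy, rfl⟩
  have hequiv : ∀ i, Nonempty (Fin (orbitCount Q (φ i) Y) ≃ O i) := fun i => by
    have : Finite (O i) := hO i
    exact ⟨(Finite.equivFinOfCardEq (Nat.card_coe_set_eq (O i))).symm⟩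
  let o := fun i => (hequiv i).some
  choose e he using fun i k => (o i k).2.2
  have heo : ∀ i k p, (o i k).1 = MulAction.orbit Q (e i k p : CAlg S r) := fun i k p => by
    obtain ⟨y, -, h⟩ := (o i k).2.1
    have hmem : (e i k p : CAlg S r) ∈ MulAction.orbit Q y := h.subset (e i k p).2
    exact h.trans (MulAction.orbit_eq_iff.2 hmem).symm
  refine ⟨fun i k p => e i k p, fun q i k p => (he i k q p).symm, ?_, ?_, ?_⟩
  · rintro ⟨i, k, p⟩ -
    obtain ⟨y, hy, h⟩ := (o i k).2.1
    exact horb y hy (h ▸ (e i k p).2)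
  · rintro ⟨i, k, p⟩ - ⟨i', k', p'⟩ - h
    have h' : (e i k p : CAlg S r) = e i' k' p' := h
    have hOO : (o i k).1 = (o i' k').1 := by rw [heo i k p, heo i' k' p', h']
    obtain rfl : i = i' := hφ.injective ((o i k).2.2.equivRep (hOO ▸ (o i' k').2.2))
    obtain rfl : k = k' := (o i).injective (Subtype.ext hOO)
    obtain rfl : p = p' := (e i k).injective (Subtype.ext h')
    rfl
  · intro y hy
    obtain ⟨i, hi⟩ := hφ.exists_hasType y (hfin.subset (horb y hy))
    obtain ⟨k, hk⟩ := (o i).surjective ⟨MulAction.orbit Q y, ⟨y, hy, rfl⟩, hi⟩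
    have hmem : y ∈ (o i k).1 := by
      rw [hk]
      exact MulAction.mem_orbit_self y
    obtain ⟨p, hp⟩ := (e i k).surjective ⟨y, hmem⟩
    exact ⟨⟨i, k, p⟩, Set.mem_univ _, congrArg Subtype.val hp⟩

end Orbits

/-! ### The bound on r_i and the image of the action -/

section Main

variable {S : CantorSystem} {r : ℕ}

/-- A basis split into families gives a decomposition of the algebra. -/
noncomputable def columnsOfBasis {J : Type} {m ρ : J → ℕ} {Y : Set (CAlg S r)} (hY : IsBasis S Y)
    (y : ∀ i, Fin (ρ i) → Fin (m i) → CAlg S r)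
    (hy : Set.BijOn (fun c : Σ i, Fin (ρ i) × Fin (m i) => y c.1 c.2.1 c.2.2) Set.univ Y) :
    Columns S (CAlg S r) m ρ where
  sat := satisfies_CAlg S r
  ι i p := CAlg.lift (satisfies_CAlg S r) fun k => y i k p
  isHom i p := CAlg.isHom_lift _ _
  exists_desc N _ hN h hh := by
    have hsurj : ∀ c : Y, ∃ x : Σ i, Fin (ρ i) × Fin (m i), y x.1 x.2.1 x.2.2 = c := fun c =>
      let ⟨x, _, hx⟩ := hy.surjOn c.2
      ⟨x, hx⟩
    choose x hx using hsurj
    obtain ⟨H, ⟨hH, hH'⟩, -⟩ := hY N hN fun c => h (x c).1 (x c).2.2 (gen S _ (x c).2.1)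
    refine ⟨H, hH, fun i p => congrFun (CAlg.hom_ext (hH.comp (CAlg.isHom_lift _ _)) (hh i p) ?_)⟩
    intro k
    have hmem : y i k p ∈ Y := hy.mapsTo (Set.mem_univ (⟨i, k, p⟩ : Σ i, Fin (ρ i) × Fin (m i)))
    have hxk : x ⟨_, hmem⟩ = ⟨i, k, p⟩ :=
      hy.injOn (Set.mem_univ _) (Set.mem_univ _) (hx ⟨_, hmem⟩)
    refine (hH' ⟨_, hmem⟩).trans ?_
    rw [hxk]
  hom_ext N _ hN h k hh hk hhk := hY.hom_ext hN hh hk fun c hc => by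
    obtain ⟨⟨i, x, p⟩, -, rfl⟩ := hy.surjOn hc
    exact hhk i p x

theorem columnsOfBasis_iUnion {J : Type} {m ρ : J → ℕ} {Y : Set (CAlg S r)} (hY : IsBasis S Y)
    (y : ∀ i, Fin (ρ i) → Fin (m i) → CAlg S r)
    (hy : Set.BijOn (fun c : Σ i, Fin (ρ i) × Fin (m i) => y c.1 c.2.1 c.2.2) Set.univ Y) :
    ⋃ i, ⋃ p, (columnsOfBasis hY y hy).ι i p '' gens S (ρ i) = Y := by
  refine Set.Subset.antisymm (Set.iUnion₂_subset ?_) fun c hc => ?_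
  · rintro i p _ ⟨_, ⟨k, rfl⟩, rfl⟩
    exact hy.mapsTo (Set.mem_univ (⟨i, k, p⟩ : Σ i, Fin (ρ i) × Fin (m i)))
  · obtain ⟨⟨i, k, p⟩, -, rfl⟩ := hy.surjOn hc
    exact Set.mem_iUnion₂.2 ⟨i, p, _, ⟨k, rfl⟩, rfl⟩

theorem Columns.ncard_iUnion (hS : HasModel S) {U J : Type} [OmegaAlgebra S U] [Fintype J]
    {m ρ : J → ℕ} (C : Columns S U m ρ) {B : ∀ i, Set (CAlg S (ρ i))}
    (hB : ∀ i, IsBasis S (B i)) :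
    (⋃ i, ⋃ p, C.ι i p '' B i).ncard = ∑ c : Σ i, Fin (m i), (B c.1).ncard := by
  have : ∀ i, Finite (B i) := fun i => (hB i).finite hS
  let F : (Σ c : Σ i, Fin (m i), B c.1) → (⋃ i, ⋃ p, C.ι i p '' B i : Set U) := fun x =>
    ⟨C.ι x.1.1 x.1.2 x.2, Set.mem_iUnion₂.2 ⟨_, _, Set.mem_image_of_mem _ x.2.2⟩⟩
  have hF : Function.Bijective F := by
    constructor
    · rintro ⟨⟨i, p⟩, b⟩ ⟨⟨j, q⟩, b'⟩ h
      have h' : C.ι i p b = C.ι j q b' := congrArg Subtype.val h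
      cases C.eq_of_ι_eq hS (hB i) b.2 h'
      rw [Subtype.ext (C.injective _ _ h')]
    · rintro ⟨x, hx⟩
      obtain ⟨i, p, b, hb, rfl⟩ := Set.mem_iUnion₂.1 hx
      exact ⟨⟨⟨i, p⟩, b, hb⟩, rfl⟩
  rw [← Nat.card_coe_set_eq, ← Nat.card_congr (Equiv.ofBijective F hF), Nat.card_sigma]
  rfl

variable {t : ℕ} {m : Fin t → ℕ} {Q : Subgroup (V S r)} {ρ : Fin t → ℕ}
  {φ : ∀ i : Fin t, Q →* Equiv.Perm (Fin (m i))}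

/-- Replacing one family of orbits by a smaller one contradicts minimality. -/
theorem IsMinFixedBasis.le_d (hS : HasModel S) (hs : 0 < S.s) {Y : Set (CAlg S r)}
    (hY : IsMinFixedBasis Q Y) (hφ : IsCompleteList φ) (C : Columns S (CAlg S r) m ρ)
    (hCY : ⋃ i, ⋃ p, C.ι i p '' gens S (ρ i) = Y)
    (hq : ∀ (q : Q) i p u, q • C.ι i p u = C.ι i (φ i q p) u) (i : Fin t) : ρ i ≤ S.d := by
  classical
  by_contra hlt
  obtain ⟨B₀, hB₀, hcard⟩ := exists_isBasis_encard_lt hS hs (not_le.1 hlt)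
  let B : ∀ j, Set (CAlg S (ρ j)) := Function.update (fun j => gens S (ρ j)) i B₀
  have hBi : B i = B₀ := Function.update_self _ _ _
  have hBj : ∀ j, j ≠ i → B j = gens S (ρ j) := fun j hj => Function.update_of_ne hj _ _
  have hB : ∀ j, IsBasis S (B j) := fun j => by
    rcases eq_or_ne j i with rfl | hj
    · rwa [hBi]
    · rw [hBj j hj]
      exact isBasis_gens
  have hbasis := C.isBasis_iUnion (B := fun i _ => B i) fun i _ => hB i
  -- The same basis is used in every copy of a block, so permuting the copies preserves the union.
  have hsub : ∀ q : Q, (fun y => q • y) '' (⋃ i, ⋃ p, C.ι i p '' B i) ⊆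
      ⋃ i, ⋃ p, C.ι i p '' B i := by
    rintro q _ ⟨_, hx, rfl⟩
    obtain ⟨j, p, b, hb, rfl⟩ := Set.mem_iUnion₂.1 hx
    exact Set.mem_iUnion₂.2 ⟨j, φ j q p, b, hb, (hq q j p b).symm⟩
  have hfixed : IsFixedBasis Q (⋃ i, ⋃ p, C.ι i p '' B i) := by
    refine ⟨hbasis, fun q => (hsub q).antisymm fun x hx => ?_⟩
    exact ⟨q⁻¹ • x, hsub q⁻¹ ⟨x, hx, rfl⟩, smul_inv_smul q x⟩
  have hle := hY.2 _ hfixed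
  rw [← (hbasis.finite hS).cast_ncard_eq, ← (hY.1.1.finite hS).cast_ncard_eq, ← hCY,
    C.ncard_iUnion hS hB, C.ncard_iUnion hS fun _ => isBasis_gens] at hle
  have hBcard : (B i).ncard < (gens S (ρ i)).ncard := by
    rw [hBi]
    have := encard_gens (S := S) (l := ρ i) hS
    rw [← this, ← (hB₀.finite hS).cast_ncard_eq,
      ← (Set.finite_range (gen S (ρ i))).cast_ncard_eq] at hcard
    exact_mod_cast hcard
  rw [Nat.cast_le] at hle
  refine hle.not_gt (Finset.sum_lt_sum (fun c _ => ?_)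
    ⟨(⟨i, ⟨0, (hφ.1 i).1⟩⟩ : Σ i, Fin (m i)), Finset.mem_univ _, hBcard⟩)
  rcases eq_or_ne c.1 i with h | h
  · rw [h]
    exact hBcard.le
  · rw [hBj _ h]

theorem range_totalHom [Finite Q] (hS : HasModel S) (hc : Confluent S) (hb : Bounded S r)
    {Y : Set (CAlg S r)} (hY : IsFixedBasis Q Y) (hφ : IsCompleteList φ)
    (C : Columns S (CAlg S r) m ρ) (hCY : ⋃ i, ⋃ p, C.ι i p '' gens S (ρ i) = Y)
    (hq : ∀ (q : Q) i p u, q • C.ι i p u = C.ι i (φ i q p) u) :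
    (C.totalHom (fun i => centRep (φ i)) hS hc).range =
      (Subgroup.centralizer (Q : Set (V S r))).map (V S r).subtype := by
  have hU := satisfies_CAlg S r
  ext g
  rw [Subgroup.mem_map]
  constructor
  · rintro ⟨x, rfl⟩
    have hmem := C.totalHom_mem_autGroup (fun i => centRep (φ i)) hS hc x
    rw [← V_eq_autGroup hS hc] at hmem
    refine ⟨⟨_, hmem⟩, Subgroup.mem_centralizer_iff.2 fun q hqQ => ?_, rfl⟩
    refine Subtype.ext (Equiv.ext fun u => ?_)
    exact (C.smul_totalHom hS hc hq (fun q => smul_mem_autGroup q) x ⟨q, hqQ⟩ u).symm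
  · rintro ⟨g, hg, rfl⟩
    have hgq : ∀ (q : Q) u, g.1 (q • u) = q • g.1 u := fun q u =>
      (congrArg (fun h : V S r => h.1 u) (Subgroup.mem_centralizer_iff.1 hg q q.2)).symm
    have hgaut := V_le_autGroup S r g.2
    -- An invariant `T` above both `Y` and `gY` is wanted: then `T` and `g⁻¹T` both refine `Y`, and
    -- `g⁻¹T` is invariant because `g` commutes with Q.
    obtain ⟨Z, hZ, hYZ, hgYZ⟩ := hY.1.exists_le_le hS hc (hY.1.image hgaut)
    obtain ⟨T, hT, hZT⟩ := exists_le_invariant hS hc hb Q (Z := Z) hY.1 fun q => by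
      have := hYZ.image (smul_mem_autGroup q)
      rwa [show (MulAction.toPerm q : Equiv.Perm (CAlg S r)) '' Y = Y from hY.2 q] at this
    have hYT : Refine S (⋃ i, ⋃ p, C.ι i p '' gens S (ρ i)) T := by
      rw [hCY]
      exact Le.refine (hYZ.trans hZT)
    have hYT' : Refine S (⋃ i, ⋃ p, C.ι i p '' gens S (ρ i)) (⇑(g.1⁻¹) '' T) := by
      have := Le.image ((autGroup S _).inv_mem hgaut) (hgYZ.trans hZT)
      rw [← Set.image_comp, ← Equiv.Perm.coe_mul, inv_mul_cancel, Equiv.Perm.coe_one,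
        Set.image_id] at this
      rw [hCY]
      exact this.refine
    obtain ⟨A, hA, hTA⟩ := C.exists_split_invariant hS hφ.1 hq hYT fun q t ht => hT.smul_mem q ht
    obtain ⟨A', hA', hTA'⟩ := C.exists_split_invariant hS hφ.1 hq hYT' (by
      rintro q _ ⟨t, ht, rfl⟩
      refine ⟨q • t, hT.smul_mem q ht, ?_⟩
      rw [Equiv.Perm.inv_eq_iff_eq, hgq, Equiv.Perm.inv_def, Equiv.apply_symm_apply])
    have hgA : g.1 '' (⋃ i, ⋃ p, C.ι i p '' A' i) = ⋃ i, ⋃ p, C.ι i p '' A i := by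
      rw [← hTA, ← hTA', ← Set.image_comp, ← Equiv.Perm.coe_mul, mul_inv_cancel,
        Equiv.Perm.coe_one, Set.image_id]
    choose x hx using C.exists_blockHom_eq hS hc hφ.1
      (fun i j p p' h => hφ.injective (equivRep_of_stabilizer_eq (hφ.1 i) (hφ.1 j) h))
      hq hgq hA hA' hgA
    refine ⟨x, Equiv.ext (congrFun ?_)⟩
    refine C.hom_ext_basis hU (C.totalHom_mem_autGroup _ hS hc x) hgaut (fun i _ => hA' i) ?_
    intro i p a ha
    rw [C.totalHom_ι, hx i p a ha]
    rfl

end Main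

end CantorAlg

open CantorAlg in
theorem theorem4p2 (S : CantorAlg.CantorSystem) (r : ℕ)
    (hvalid : CantorAlg.Valid S r) (hbounded : CantorAlg.Bounded S r)
    (Q : Subgroup (CantorAlg.V S r)) [Finite Q]
    (t : ℕ) (m : Fin t → ℕ) (φ : ∀ i : Fin t, Q →* Equiv.Perm (Fin (m i)))
    (hφ : CantorAlg.IsCompleteList φ) :
    (∃ Y, CantorAlg.IsMinFixedBasis Q Y) ∧
    ∀ Y, CantorAlg.IsMinFixedBasis Q Y →
      (0 < S.s → ∀ i, CantorAlg.orbitCount Q (φ i) Y ≤ S.d) ∧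
      Nonempty (Subgroup.centralizer (Q : Set (CantorAlg.V S r)) ≃*
        ∀ i : Fin t, CantorAlg.GFactor S (CantorAlg.orbitCount Q (φ i) Y)
          (CantorAlg.centRep (φ i))) := by
  -- In rank zero the algebra is empty and validity gives no model, but all groups involved are
  -- trivial.
  rcases Nat.eq_zero_or_pos r with rfl | hr
  · refine ⟨exists_isMinFixedBasis ⟨gens S 0, isBasis_gens, fun q => Subsingleton.elim _ _⟩,
      fun Y _ => ?_⟩
    have h0 : ∀ i, orbitCount Q (φ i) Y = 0 := fun i => by
      rw [orbitCount, Set.eq_empty_of_forall_notMem (s := {O | _}), Set.ncard_empty]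
      rintro _ ⟨⟨y, -⟩, -⟩
      exact isEmptyElim y
    have := fun i => subsingleton_gFactor (S := S) (L := centRep (φ i)) (h0 i)
    refine ⟨fun _ i => (h0 i).trans_le (Nat.zero_le _), ⟨⟨⟨1, 1, fun x => ?_, fun x => ?_⟩, ?_⟩⟩⟩
    · exact Subtype.ext (Subsingleton.elim _ _)
    · exact Subsingleton.elim _ _
    · exact fun _ _ => Subsingleton.elim _ _
  · have hS := hvalid.hasModel hr
    have hc := confluent_of_bounded hS hbounded hr
    refine ⟨exists_isMinFixedBasis (exists_isFixedBasis hS hc hbounded Q), fun Y hY => ?_⟩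
    obtain ⟨y, hqy, hy⟩ := exists_coordinates hS hφ hY.1
    let C := columnsOfBasis hY.1.1 y hy
    have hCY := columnsOfBasis_iUnion hY.1.1 y hy
    have hq : ∀ (q : Q) i p u, q • C.ι i p u = C.ι i (φ i q p) u := fun q i p u =>
      congrFun (CAlg.hom_ext ((smul_mem_autGroup q : IsHom S _).comp (C.isHom i p))
        (C.isHom i _) fun k => hqy q i k p) u
    refine ⟨fun hs i => hY.le_d hS hs hφ C hCY hq i, ⟨?_⟩⟩
    have hinj := C.totalHom_injective (fun i => centRep (φ i)) hS hc fun i => (hφ.1 i).1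
    exact ((Subgroup.equivMapOfInjective _ _ (V S r).subtype_injective).trans
      (MulEquiv.subgroupCongr (range_totalHom hS hc hbounded hY.1 hφ C hCY hq).symm)).trans
      (MonoidHom.ofInjective hinj).symm
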